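/- Let $\mathbb K=\mathbb R$ or $\mathbb C$, $d,q\in\mathbb N=\{1,2,\dots\}$, let $\Omega\subset\mathbb R^d$ be open, $(\Omega_n)_{n\in\mathbb N}$ non-empty open sets with $\Omega_n\subset\Omega_{n+1}$ and $\Omega=\bigcup_n\Omega_n$, and $\mathcal V=(\nu_n)_{n\in\mathbb N}$ continuous functions $\nu_n\colon\Omega\to(0,\infty)$ with $\nu_n\le\nu_{n+1}$. Functions are $\mathbb K$-valued. For $n\in\mathbb N$, $m\in\mathbb N_0$ put $$|f|_{n,m}:=\sup_{x\in\Omega_n,\ |\beta|\le m}|\partial^\beta f(x)|\,\nu_n(x),\qquad \|f\|_{n,m,q}:=\sup_{|\alpha|\le m}\Bigl(\int_{\Omega_n}|\partial^\alpha f(x)|^q\nu_n(x)^q\,dx\Bigr)^{1/q},$$ $$\mathcal E\nu_n(\Omega_n):=\{f\in C^\infty(\Omega_n):\forall m\in\mathbb N_0:\ |f|_{n,m}<\infty\},\qquad \mathcal C^\infty_q\nu_n(\Omega_n):=\{f\in C^\infty(\Omega_n):\forall m\in\mathbb N_0:\ \|f\|_{n,m,q}<\infty\}.$$ Let $\mathcal{EV}(\Omega)$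 (resp. $\mathcal C^\infty_q\mathcal V(\Omega)$) be the space of all $f\in C^\infty(\Omega)$ with $f|_{\Omega_n}\in\mathcal E\nu_n(\Omega_n)$ (resp. $f|_{\Omega_n}\in\mathcal C^\infty_q\nu_n(\Omega_n)$) for all $n\in\mathbb N$, with the locally convex topology of the seminorms $|\cdot|_{n,m}$ (resp. $\|\cdot\|_{n,m,q}$), $n\in\mathbb N$, $m\in\mathbb N_0$. Assume that for every $k\in\mathbb N$ there is $\rho_k>0$ such that $\rho_k$ is smaller than the $\|\cdot\|_\infty$-distance of $x$ to $\partial\Omega_{k+1}$ (which is $\infty$ if $\partial\Omega_{k+1}=\emptyset$) for all $x\in\Omega_k$, and that for all $k,n\in\mathbb N$ there are $\psi_n\in L^q(\Omega_k)$ with $\psi_n>0$, indices $J_1(n),J_2(n)\ge n$ and constants $C_1(n),C_2(n)>0$ (all of which may depend on $k$) such that for every $x\in\Omega_k$ $$\sup_{\|\zeta\|_\infty\le\rho_k}\nu_n(x+\zeta)\le C_1(n)\inf_{\|\zeta\|_\infty\le\rho_k}\nu_{J_1(n)}(x+\zeta),\qquad \nu_n(x)\le C_2(n)\,\psi_n(x)\,\nu_{J_2(n)}(x).$$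 Fix such a choice of data, and for $n\in\mathbb N$ let $N:=2J_1(J_1(n))$, where both occurrences of $J_1$ belong to $k=n$. (a) Let $P$ be a polynomial in $d$ variables with coefficients in $\mathbb K$ such that $P(\partial)$ is hypoelliptic, i.e. for every open $U\subset\mathbb R^d$, every distribution $T$ on $U$ for which $P(\partial)T$ is a smooth function is itself a smooth function, and let $n\in\mathbb N$. If $f\in C^\infty(\Omega_N)$ satisfies $\|f\|_{N,0,q}<\infty$ and $P(\partial)f\in\mathcal C^\infty_q\nu_N(\Omega_N)$, then $f|_{\Omega_n}\in\mathcal E\nu_n(\Omega_n)$. Moreover, for every $m\in\mathbb N_0$ there are $l\in\mathbb N_0$ and $C_0>0$ such that for all such $f$ $$|f|_{n,m}\le C_0\bigl(\|f\|_{N,0,q}+\|P(\partial)f\|_{N,l,q}\bigr).$$ (b) $\mathcal C^\infty_q\mathcal V(\Omega)=\mathcal{EV}(\Omega)$ as locally convex spaces, i.e. they consist of the same functions and carry the same topology. -/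

import Mathlib

open Set MeasureTheory TopologicalSpace
open scoped ENNReal NNReal ContDiff Distributions LineDeriv

noncomputable section

namespace WeightedSmooth

/-! ### Partial derivatives and constant coefficient operators

The space `Fin d → ℝ` carries the sup norm, its usual topology and Lebesgue measure `volume`. -/

section Derivatives

variable {𝕜 : Type*} [RCLike 𝕜] {d : ℕ}

/-- The partial derivative `∂_i f`: the limit of difference quotients along the `i`-th unit
vector. -/
def pderiv (i : Fin d) (f : (Fin d → ℝ) → 𝕜) : (Fin d → ℝ) → 𝕜 :=
  fun x => lineDeriv ℝ f x (Pi.single i 1)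

/-- The order `|α| = α_1 + ... + α_d` of a multi-index. -/
def order (α : Fin d →₀ ℕ) : ℕ := ∑ i, α i

/-- The iterated partial derivative `∂^α f = ∂_1^{α_1} ... ∂_d^{α_d} f`. -/
def multiDeriv (α : Fin d →₀ ℕ) (f : (Fin d → ℝ) → 𝕜) : (Fin d → ℝ) → 𝕜 :=
  (List.finRange d).foldr (fun i g => (pderiv i)^[α i] g) f

/-- The operator `P(∂) f = ∑_α c_α ∂^α f` for a polynomial `P = ∑_α c_α ζ^α`. -/
def diffOp (P : MvPolynomial (Fin d) 𝕜) (f : (Fin d → ℝ) → 𝕜) : (Fin d → ℝ) → 𝕜 :=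
  fun x => ∑ α ∈ P.support, P.coeff α * multiDeriv α f x

/-- The derivative `∂^α T` of a distribution `T` on `U`. -/
def distMultiDeriv {U : Opens (Fin d → ℝ)} (α : Fin d →₀ ℕ) (T : 𝓓'(U, 𝕜)) : 𝓓'(U, 𝕜) :=
  (List.finRange d).foldr
    (fun i S => (fun R : 𝓓'(U, 𝕜) => ∂_{(Pi.single i 1 : Fin d → ℝ)} R)^[α i] S) T

/-- The distribution `P(∂) T = ∑_α c_α ∂^α T`. -/
def distDiffOp {U : Opens (Fin d → ℝ)} (P : MvPolynomial (Fin d) 𝕜) (T : 𝓓'(U, 𝕜)) :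
    𝓓'(U, 𝕜) :=
  ∑ α ∈ P.support, P.coeff α • distMultiDeriv α T

/-- The distribution `T` on `U` is (the regular distribution of) a smooth function on `U`. -/
def IsSmoothDist {U : Opens (Fin d → ℝ)} (T : 𝓓'(U, 𝕜)) : Prop :=
  ∃ g : (Fin d → ℝ) → 𝕜, ContDiffOn ℝ ∞ g U ∧ ∀ φ : 𝓓(U, ℝ), T φ = ∫ x, φ x • g x

/-- `P(∂)` is hypoelliptic: on every open set `U`, a distribution `T` is smooth as soon as
`P(∂) T` is smooth. -/
def IsHypoelliptic (P : MvPolynomial (Fin d) 𝕜) : Prop :=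
  ∀ (U : Opens (Fin d → ℝ)) (T : 𝓓'(U, 𝕜)), IsSmoothDist (distDiffOp P T) → IsSmoothDist T

/-! Helper facts: `∂^α` is linear on smooth functions and local. -/

variable {U : Set (Fin d → ℝ)} {f g : (Fin d → ℝ) → 𝕜}

lemma pderiv_eqOn_fderiv (hU : IsOpen U) (hf : ContDiffOn ℝ ∞ f U) (i : Fin d) :
    EqOn (pderiv i f) (fun x => fderiv ℝ f x (Pi.single i 1)) U := fun x hx =>
  ((hf.contDiffAt (hU.mem_nhds hx)).differentiableAt (by simp)).lineDeriv_eq_fderiv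

lemma contDiffOn_pderiv (hU : IsOpen U) (hf : ContDiffOn ℝ ∞ f U) (i : Fin d) :
    ContDiffOn ℝ ∞ (pderiv i f) U :=
  ((hf.fderiv_of_isOpen hU (m := ∞) (by simp)).clm_apply contDiffOn_const).congr
    (pderiv_eqOn_fderiv hU hf i)

lemma pderiv_congr (hU : IsOpen U) (h : EqOn f g U) (i : Fin d) :
    EqOn (pderiv i f) (pderiv i g) U := fun _ hx =>
  (h.eventuallyEq_of_mem (hU.mem_nhds hx)).lineDeriv_eq

lemma pderiv_lin (hU : IsOpen U) (hf : ContDiffOn ℝ ∞ f U) (hg : ContDiffOn ℝ ∞ g U)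
    (a b : 𝕜) (i : Fin d) :
    EqOn (pderiv i (a • f + b • g)) (a • pderiv i f + b • pderiv i g) U := by
  intro x hx
  have hf' := (hf.contDiffAt (hU.mem_nhds hx)).differentiableAt (by simp)
  have hg' := (hg.contDiffAt (hU.mem_nhds hx)).differentiableAt (by simp)
  have h1 := (hf'.hasFDerivAt.hasLineDerivAt (Pi.single i 1))
  have h2 := (hg'.hasFDerivAt.hasLineDerivAt (Pi.single i 1))
  have h3 : HasLineDerivAt ℝ (a • f + b • g) _ x (Pi.single i 1) :=
    HasDerivAt.add (HasDerivAt.const_smul a h1) (HasDerivAt.const_smul b h2)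
  simp only [pderiv, Pi.add_apply, Pi.smul_apply]
  rw [h1.lineDeriv, h2.lineDeriv]
  exact h3.lineDeriv

/-- An operation that preserves smoothness on `U`, is local and linear there. -/
structure LocalLinear (U : Set (Fin d → ℝ))
    (D : ((Fin d → ℝ) → 𝕜) → ((Fin d → ℝ) → 𝕜)) : Prop where
  smooth : ∀ f, ContDiffOn ℝ ∞ f U → ContDiffOn ℝ ∞ (D f) U
  congr : ∀ f g, EqOn f g U → EqOn (D f) (D g) U
  lin : ∀ f g, ContDiffOn ℝ ∞ f U → ContDiffOn ℝ ∞ g U → ∀ a b : 𝕜,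
    EqOn (D (a • f + b • g)) (a • D f + b • D g) U

lemma LocalLinear.comp {D D' : ((Fin d → ℝ) → 𝕜) → ((Fin d → ℝ) → 𝕜)}
    (h : LocalLinear U D) (h' : LocalLinear U D') : LocalLinear U (fun f => D (D' f)) where
  smooth f hf := h.smooth _ (h'.smooth f hf)
  congr f g hfg := h.congr _ _ (h'.congr f g hfg)
  lin f g hf hg a b := (h.congr _ _ (h'.lin f g hf hg a b)).trans
    (h.lin _ _ (h'.smooth f hf) (h'.smooth g hg) a b)

lemma LocalLinear.id : LocalLinear (𝕜 := 𝕜) U (fun f => f) where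
  smooth _ hf := hf
  congr _ _ h := h
  lin _ _ _ _ _ _ := fun _ _ => rfl

lemma LocalLinear.iterate {D : ((Fin d → ℝ) → 𝕜) → ((Fin d → ℝ) → 𝕜)}
    (h : LocalLinear U D) (n : ℕ) : LocalLinear U (D^[n]) := by
  induction n with
  | zero => exact LocalLinear.id
  | succ n ih => exact ih.comp h

lemma localLinear_multiDeriv (hU : IsOpen U) (α : Fin d →₀ ℕ) :
    LocalLinear (𝕜 := 𝕜) U (multiDeriv α) := by
  unfold multiDeriv
  induction List.finRange d with
  | nil => exact LocalLinear.id
  | cons i l ih =>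
    have hi : LocalLinear (𝕜 := 𝕜) U (pderiv i) :=
      ⟨fun _ hf => contDiffOn_pderiv hU hf i, fun _ _ h => pderiv_congr hU h i,
        fun _ _ hf hg a b => pderiv_lin hU hf hg a b i⟩
    exact (hi.iterate (α i)).comp ih

end Derivatives

/-! ### Weighted seminorms -/

section Seminorms

variable {𝕜 : Type*} [RCLike 𝕜] {d : ℕ}

/-- `sup_{x ∈ U, |β| ≤ m} |∂^β f(x)| w(x)`, with values in `[0, ∞]`. -/
def supNorm (U : Set (Fin d → ℝ)) (w : (Fin d → ℝ) → ℝ) (m : ℕ) (f : (Fin d → ℝ) → 𝕜) : ℝ≥0∞ :=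
  ⨆ (β : Fin d →₀ ℕ) (_ : order β ≤ m) (x : Fin d → ℝ) (_ : x ∈ U),
    ‖multiDeriv β f x‖ₑ * ENNReal.ofReal (w x)

/-- `sup_{|α| ≤ m} (∫_U |∂^α f(x)|^q w(x)^q dx)^{1/q}`, with values in `[0, ∞]`. -/
def lqNorm (q : ℕ) (U : Set (Fin d → ℝ)) (w : (Fin d → ℝ) → ℝ) (m : ℕ)
    (f : (Fin d → ℝ) → 𝕜) : ℝ≥0∞ :=
  ⨆ (α : Fin d →₀ ℕ) (_ : order α ≤ m),
    eLpNorm (fun x => w x • multiDeriv α f x) (q : ℝ≥0∞) (volume.restrict U)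

variable {U : Set (Fin d → ℝ)} {w : (Fin d → ℝ) → ℝ} {m : ℕ} {f g : (Fin d → ℝ) → 𝕜}

lemma supNorm_add_le (hU : IsOpen U) (hf : ContDiffOn ℝ ∞ f U) (hg : ContDiffOn ℝ ∞ g U) :
    supNorm U w m (f + g) ≤ supNorm U w m f + supNorm U w m g := by
  refine iSup₂_le fun β hβ => iSup₂_le fun x hx => ?_
  have h : multiDeriv β (f + g) x = multiDeriv β f x + multiDeriv β g x := by
    simpa using (localLinear_multiDeriv (𝕜 := 𝕜) hU β).lin f g hf hg 1 1 hx
  calc ‖multiDeriv β (f + g) x‖ₑ * ENNReal.ofReal (w x)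
      ≤ (‖multiDeriv β f x‖ₑ + ‖multiDeriv β g x‖ₑ) * ENNReal.ofReal (w x) := by
        rw [h]; gcongr; exact enorm_add_le _ _
    _ ≤ supNorm U w m f + supNorm U w m g := by
        rw [add_mul]
        exact add_le_add
          (le_iSup₂_of_le β hβ (le_iSup₂_of_le x hx le_rfl))
          (le_iSup₂_of_le β hβ (le_iSup₂_of_le x hx le_rfl))

lemma supNorm_smul (hU : IsOpen U) (hf : ContDiffOn ℝ ∞ f U) (a : 𝕜) :
    supNorm U w m (a • f) = ‖a‖ₑ * supNorm U w m f := by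
  simp only [supNorm, ENNReal.mul_iSup]
  refine iSup_congr fun β => iSup_congr fun _ => iSup_congr fun x => iSup_congr fun hx => ?_
  have h : multiDeriv β (a • f) x = a • multiDeriv β f x := by
    simpa using (localLinear_multiDeriv (𝕜 := 𝕜) hU β).lin f f hf hf a 0 hx
  rw [h, enorm_smul, mul_assoc]

lemma lqNorm_add_le {q : ℕ} (hq : 0 < q) (hU : IsOpen U) (hw : ContinuousOn w U)
    (hf : ContDiffOn ℝ ∞ f U) (hg : ContDiffOn ℝ ∞ g U) :
    lqNorm q U w m (f + g) ≤ lqNorm q U w m f + lqNorm q U w m g := by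
  refine iSup₂_le fun β hβ => ?_
  have hL := localLinear_multiDeriv (𝕜 := 𝕜) hU β
  have hm : ∀ f : (Fin d → ℝ) → 𝕜, ContDiffOn ℝ ∞ f U →
      AEStronglyMeasurable (fun x => w x • multiDeriv β f x) (volume.restrict U) := fun f hf =>
    (hw.smul (hL.smooth f hf).continuousOn).aestronglyMeasurable hU.measurableSet
  have h : eLpNorm (fun x => w x • multiDeriv β (f + g) x) (q : ℝ≥0∞) (volume.restrict U) =
      eLpNorm ((fun x => w x • multiDeriv β f x) + fun x => w x • multiDeriv β g x) (q : ℝ≥0∞)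
        (volume.restrict U) := by
    refine eLpNorm_congr_ae ((ae_restrict_mem hU.measurableSet).mono fun x hx => ?_)
    have h' : multiDeriv β (f + g) x = multiDeriv β f x + multiDeriv β g x := by
      simpa using hL.lin f g hf hg 1 1 hx
    simp [h', smul_add]
  rw [h]
  refine (eLpNorm_add_le (hm f hf) (hm g hg) (by exact_mod_cast hq)).trans ?_
  exact add_le_add
    (le_iSup₂_of_le (f := fun (α : Fin d →₀ ℕ) (_ : order α ≤ m) =>
      eLpNorm (fun x => w x • multiDeriv α f x) (q : ℝ≥0∞) (volume.restrict U)) β hβ le_rfl)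
    (le_iSup₂_of_le (f := fun (α : Fin d →₀ ℕ) (_ : order α ≤ m) =>
      eLpNorm (fun x => w x • multiDeriv α g x) (q : ℝ≥0∞) (volume.restrict U)) β hβ le_rfl)

lemma lqNorm_smul {q : ℕ} (hU : IsOpen U) (hf : ContDiffOn ℝ ∞ f U) (a : 𝕜) :
    lqNorm q U w m (a • f) = ‖a‖ₑ * lqNorm q U w m f := by
  simp only [lqNorm, ENNReal.mul_iSup]
  refine iSup_congr fun β => iSup_congr fun _ => ?_
  rw [← eLpNorm_const_smul]
  refine eLpNorm_congr_ae ((ae_restrict_mem hU.measurableSet).mono fun x hx => ?_)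
  have h : multiDeriv β (a • f) x = a • multiDeriv β f x := by
    simpa using (localLinear_multiDeriv (𝕜 := 𝕜) hU β).lin f f hf hf a 0 hx
  simp only [h, Pi.smul_apply]
  exact smul_comm _ _ _

end Seminorms

/-! ### Weight systems and the weighted spaces -/

/-- An open set `Ω ⊆ ℝ^d`, an increasing family of non-empty open sets `Ω_n` with union `Ω`, and an
increasing family of positive continuous weights `ν_n` on `Ω` (`n = 1, 2, ...`); the values of
`ν_n` off `Ω` are irrelevant. -/
structure WeightSystem (d : ℕ) where
  /-- the open set `Ω` -/
  dom : Opens (Fin d → ℝ)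
  /-- the open sets `Ω_n` -/
  sub : ℕ+ → Opens (Fin d → ℝ)
  sub_nonempty : ∀ n, (sub n : Set (Fin d → ℝ)).Nonempty
  sub_mono : ∀ n, sub n ≤ sub (n + 1)
  dom_eq : (dom : Set (Fin d → ℝ)) = ⋃ n, (sub n : Set (Fin d → ℝ))
  /-- the weights `ν_n` -/
  weight : ℕ+ → (Fin d → ℝ) → ℝ
  weight_pos : ∀ n, ∀ x ∈ dom, 0 < weight n x
  weight_continuousOn : ∀ n, ContinuousOn (weight n) dom
  weight_mono : ∀ n, ∀ x ∈ dom, weight n x ≤ weight (n + 1) x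

namespace WeightSystem

variable {d : ℕ} (V : WeightSystem d)

lemma sub_le (n : ℕ+) : V.sub n ≤ V.dom := by
  intro x hx
  have : x ∈ (V.dom : Set (Fin d → ℝ)) := by
    rw [V.dom_eq]; exact mem_iUnion.2 ⟨n, hx⟩
  exact this

/-- The condition on the weights with exponent `q`, together with a choice of the data in it. For
every `k` there is a radius `ρ_k`, smaller than the sup-norm distance of each `x ∈ Ω_k` to the
boundary of `Ω_{k+1}` (which is `∞` if the boundary is empty), and for every `n` there are a
positive `ψ_n ∈ L^q(Ω_k)`, indices `J_i(n) ≥ n` and constants `C_i(n) > 0` with the two estimates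
below on `Ω_k`. All of these may depend on `k`, the first argument. -/
structure Condition (q : ℕ) where
  ρ : ℕ+ → ℝ
  ρ_pos : ∀ k, 0 < ρ k
  ρ_lt : ∀ k, ∀ x ∈ V.sub k,
    ENNReal.ofReal (ρ k) < Metric.infEDist x (frontier (V.sub (k + 1) : Set (Fin d → ℝ)))
  ψ : ℕ+ → ℕ+ → (Fin d → ℝ) → ℝ
  ψ_memLp : ∀ k n, MemLp (ψ k n) (q : ℝ≥0∞) (volume.restrict (V.sub k : Set (Fin d → ℝ)))
  ψ_pos : ∀ k n, ∀ x ∈ V.sub k, 0 < ψ k n x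
  J₁ : ℕ+ → ℕ+ → ℕ+
  J₂ : ℕ+ → ℕ+ → ℕ+
  le_J₁ : ∀ k n, n ≤ J₁ k n
  le_J₂ : ∀ k n, n ≤ J₂ k n
  C₁ : ℕ+ → ℕ+ → ℝ
  C₂ : ℕ+ → ℕ+ → ℝ
  C₁_pos : ∀ k n, 0 < C₁ k n
  C₂_pos : ∀ k n, 0 < C₂ k n
  /-- `sup_{‖ζ‖_∞ ≤ ρ_k} ν_n(x+ζ) ≤ C_1(n) inf_{‖ζ‖_∞ ≤ ρ_k} ν_{J_1(n)}(x+ζ)` -/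
  omega_one : ∀ k n, ∀ x ∈ V.sub k,
    sSup (V.weight n '' Metric.closedBall x (ρ k)) ≤
      C₁ k n * sInf (V.weight (J₁ k n) '' Metric.closedBall x (ρ k))
  /-- `ν_n(x) ≤ C_2(n) ψ_n(x) ν_{J_2(n)}(x)` -/
  omega_two : ∀ k n, ∀ x ∈ V.sub k,
    V.weight n x ≤ C₂ k n * ψ k n x * V.weight (J₂ k n) x

variable {𝕜 : Type*} [RCLike 𝕜]

/-- The seminorm `|f|_{n,m} = sup_{x ∈ Ω_n, |β| ≤ m} |∂^β f(x)| ν_n(x)`. -/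
def supNormAt (n : ℕ+) (m : ℕ) (f : (Fin d → ℝ) → 𝕜) : ℝ≥0∞ :=
  supNorm (V.sub n) (V.weight n) m f

/-- The seminorm
`‖f‖_{n,m,q} = sup_{|α| ≤ m} (∫_{Ω_n} |∂^α f(x)|^q ν_n(x)^q dx)^{1/q}`. -/
def lqNormAt (q : ℕ) (n : ℕ+) (m : ℕ) (f : (Fin d → ℝ) → 𝕜) : ℝ≥0∞ :=
  lqNorm q (V.sub n) (V.weight n) m f

/-- The restriction of `f` to `Ω_n` belongs to `Eν_n(Ω_n)`. -/
def MemE (n : ℕ+) (f : (Fin d → ℝ) → 𝕜) : Prop :=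
  ContDiffOn ℝ ∞ f (V.sub n) ∧ ∀ m, V.supNormAt n m f < ⊤

/-- The restriction of `f` to `Ω_n` belongs to `C^∞_q ν_n(Ω_n)`. -/
def MemC (q : ℕ) (n : ℕ+) (f : (Fin d → ℝ) → 𝕜) : Prop :=
  ContDiffOn ℝ ∞ f (V.sub n) ∧ ∀ m, V.lqNormAt q n m f < ⊤

/-- The extension by zero of a function on `Ω`; it only serves to express the derivatives on the
open set `Ω` and its subsets. -/
def ext (f : V.dom → 𝕜) : (Fin d → ℝ) → 𝕜 := Function.extend Subtype.val f 0

lemma ext_add (f g : V.dom → 𝕜) : V.ext (f + g) = V.ext f + V.ext g := by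
  have := Function.extend_add (Subtype.val : V.dom → (Fin d → ℝ)) f g 0 0
  simpa [ext] using this

lemma ext_smul (a : 𝕜) (f : V.dom → 𝕜) : V.ext (a • f) = a • V.ext f := by
  have := Function.extend_smul a (Subtype.val : V.dom → (Fin d → ℝ)) f 0
  simpa [ext] using this

lemma ext_zero : V.ext (0 : V.dom → 𝕜) = 0 := by
  simpa using V.ext_smul (0 : 𝕜) 0

variable (𝕜) in
/-- The space `C^∞(Ω)`. -/
def smooth : Submodule 𝕜 (V.dom → 𝕜) where
  carrier := {f | ContDiffOn ℝ ∞ (V.ext f) V.dom}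
  add_mem' hf hg := by
    simp only [mem_ofPred_eq, ext_add] at *
    exact hf.add hg
  zero_mem' := by
    simp only [mem_ofPred_eq, ext_zero]
    exact contDiffOn_const
  smul_mem' a f hf := by
    simp only [mem_ofPred_eq, ext_smul] at *
    exact hf.const_smul a

lemma smooth_on {f : V.dom → 𝕜} (hf : f ∈ V.smooth 𝕜) (n : ℕ+) :
    ContDiffOn ℝ ∞ (V.ext f) (V.sub n) :=
  ContDiffOn.mono hf (V.sub_le n)

lemma supNormAt_add_le {f g : V.dom → 𝕜} (hf : f ∈ V.smooth 𝕜) (hg : g ∈ V.smooth 𝕜)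
    (n : ℕ+) (m : ℕ) :
    V.supNormAt n m (V.ext (f + g)) ≤ V.supNormAt n m (V.ext f) + V.supNormAt n m (V.ext g) := by
  rw [ext_add]
  exact supNorm_add_le (V.sub n).isOpen (V.smooth_on hf n) (V.smooth_on hg n)

lemma supNormAt_smul {f : V.dom → 𝕜} (hf : f ∈ V.smooth 𝕜) (a : 𝕜) (n : ℕ+) (m : ℕ) :
    V.supNormAt n m (V.ext (a • f)) = ‖a‖ₑ * V.supNormAt n m (V.ext f) := by
  rw [ext_smul]
  exact supNorm_smul (V.sub n).isOpen (V.smooth_on hf n) a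

lemma lqNormAt_add_le {q : ℕ} (hq : 0 < q) {f g : V.dom → 𝕜} (hf : f ∈ V.smooth 𝕜)
    (hg : g ∈ V.smooth 𝕜) (n : ℕ+) (m : ℕ) :
    V.lqNormAt q n m (V.ext (f + g)) ≤
      V.lqNormAt q n m (V.ext f) + V.lqNormAt q n m (V.ext g) := by
  rw [ext_add]
  exact lqNorm_add_le hq (V.sub n).isOpen ((V.weight_continuousOn n).mono (V.sub_le n))
    (V.smooth_on hf n) (V.smooth_on hg n)

lemma lqNormAt_smul {q : ℕ} {f : V.dom → 𝕜} (hf : f ∈ V.smooth 𝕜) (a : 𝕜) (n : ℕ+) (m : ℕ) :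
    V.lqNormAt q n m (V.ext (a • f)) = ‖a‖ₑ * V.lqNormAt q n m (V.ext f) := by
  rw [ext_smul]
  exact lqNorm_smul (V.sub n).isOpen (V.smooth_on hf n) a

variable (𝕜) in
/-- The space `EV(Ω)` of smooth functions on `Ω` whose restrictions to `Ω_n` lie in `Eν_n(Ω_n)` for
all `n`. -/
def spaceE : Submodule 𝕜 (V.dom → 𝕜) where
  carrier := {f | f ∈ V.smooth 𝕜 ∧ ∀ n, V.MemE n (V.ext f)}
  add_mem' {f g} hf hg := by
    have h := (V.smooth 𝕜).add_mem hf.1 hg.1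
    exact ⟨h, fun n => ⟨V.smooth_on h n, fun m => (V.supNormAt_add_le hf.1 hg.1 n m).trans_lt
      (ENNReal.add_lt_top.2 ⟨(hf.2 n).2 m, (hg.2 n).2 m⟩)⟩⟩
  zero_mem' := by
    have h := (V.smooth 𝕜).zero_mem
    refine ⟨h, fun n => ⟨V.smooth_on h n, fun m => ?_⟩⟩
    have := V.supNormAt_smul h (0 : 𝕜) n m
    rw [smul_zero] at this
    rw [this, enorm_zero, zero_mul]
    exact ENNReal.zero_lt_top
  smul_mem' a f hf := by
    have h := (V.smooth 𝕜).smul_mem a hf.1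
    refine ⟨h, fun n => ⟨V.smooth_on h n, fun m => ?_⟩⟩
    rw [V.supNormAt_smul hf.1]
    exact ENNReal.mul_lt_top enorm_lt_top ((hf.2 n).2 m)

variable (𝕜) in
/-- The space `C^∞_q V(Ω)` of smooth functions on `Ω` whose restrictions to `Ω_n` lie in
`C^∞_q ν_n(Ω_n)` for all `n`. -/
def spaceC (q : ℕ) [NeZero q] : Submodule 𝕜 (V.dom → 𝕜) where
  carrier := {f | f ∈ V.smooth 𝕜 ∧ ∀ n, V.MemC q n (V.ext f)}
  add_mem' {f g} hf hg := by
    have h := (V.smooth 𝕜).add_mem hf.1 hg.1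
    exact ⟨h, fun n => ⟨V.smooth_on h n, fun m =>
      (V.lqNormAt_add_le (NeZero.pos q) hf.1 hg.1 n m).trans_lt
        (ENNReal.add_lt_top.2 ⟨(hf.2 n).2 m, (hg.2 n).2 m⟩)⟩⟩
  zero_mem' := by
    have h := (V.smooth 𝕜).zero_mem
    refine ⟨h, fun n => ⟨V.smooth_on h n, fun m => ?_⟩⟩
    have := V.lqNormAt_smul (q := q) h (0 : 𝕜) n m
    rw [smul_zero] at this
    rw [this, enorm_zero, zero_mul]
    exact ENNReal.zero_lt_top
  smul_mem' a f hf := by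
    have h := (V.smooth 𝕜).smul_mem a hf.1
    refine ⟨h, fun n => ⟨V.smooth_on h n, fun m => ?_⟩⟩
    rw [V.lqNormAt_smul hf.1]
    exact ENNReal.mul_lt_top enorm_lt_top ((hf.2 n).2 m)

variable (𝕜) in
/-- The seminorms `|f|_{n,m}` on `EV(Ω)`. -/
def seminormE : SeminormFamily 𝕜 (V.spaceE 𝕜) (ℕ+ × ℕ) := fun p =>
  Seminorm.of (fun f => (V.supNormAt p.1 p.2 (V.ext (f : V.dom → 𝕜))).toReal)
    (fun f g => by
      rw [← ENNReal.toReal_add ((f.2.2 p.1).2 p.2).ne ((g.2.2 p.1).2 p.2).ne]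
      exact ENNReal.toReal_mono
        (ENNReal.add_lt_top.2 ⟨(f.2.2 p.1).2 p.2, (g.2.2 p.1).2 p.2⟩).ne
        (V.supNormAt_add_le f.2.1 g.2.1 p.1 p.2))
    (fun a f => by
      rw [Submodule.coe_smul, V.supNormAt_smul f.2.1, ENNReal.toReal_mul, toReal_enorm])

variable (𝕜) in
/-- The seminorms `‖f‖_{n,m,q}` on `C^∞_q V(Ω)`. -/
def seminormC (q : ℕ) [NeZero q] : SeminormFamily 𝕜 (V.spaceC 𝕜 q) (ℕ+ × ℕ) := fun p =>
  Seminorm.of (fun f => (V.lqNormAt q p.1 p.2 (V.ext (f : V.dom → 𝕜))).toReal)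
    (fun f g => by
      rw [← ENNReal.toReal_add ((f.2.2 p.1).2 p.2).ne ((g.2.2 p.1).2 p.2).ne]
      exact ENNReal.toReal_mono
        (ENNReal.add_lt_top.2 ⟨(f.2.2 p.1).2 p.2, (g.2.2 p.1).2 p.2⟩).ne
        (V.lqNormAt_add_le (NeZero.pos q) f.2.1 g.2.1 p.1 p.2))
    (fun a f => by
      rw [Submodule.coe_smul, V.lqNormAt_smul f.2.1, ENNReal.toReal_mul, toReal_enorm])

variable (𝕜) in
/-- The locally convex topology of `EV(Ω)` given by its seminorms. -/
@[reducible] def topologyE : TopologicalSpace (V.spaceE 𝕜) := (V.seminormE 𝕜).moduleFilterBasis.topology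

variable (𝕜) in
/-- The locally convex topology of `C^∞_q V(Ω)` given by its seminorms. -/
@[reducible] def topologyC (q : ℕ) [NeZero q] : TopologicalSpace (V.spaceC 𝕜 q) :=
  (V.seminormC 𝕜 q).moduleFilterBasis.topology

end WeightSystem

end WeightedSmooth

end

/-! Everything rests on an interior estimate for hypoelliptic `P(∂)`: on a ball of fixed radius,
`|∂^β f|` at the centre is at most a constant times the `L^q` norm of `f` plus some Sobolev norm of
`P(∂) f` (`exists_enorm_multiDeriv_le`). Constant coefficients make it translation invariant, so the
constants do not depend on the centre.

The estimate is proved by contradiction, with Banach-Steinhaus on `ℓ^1`. Rescaled counterexamples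
give a sequence `h_l`, bounded in `L^1`, with `P(∂) h_l` bounded in every Sobolev norm but `|∂^β
h_l(0)| = l`. For every `c ∈ ℓ^1` the sum `T = ∑ c_l h_l` is an integrable function. A crude Sobolev
inequality and the Weierstrass M-test make `P(∂) T` smooth on a smaller ball, so hypoellipticity
makes `T` smooth there (`exists_contDiffOn_hasSum_integral`). Hence the functionals `c ↦ ∑ c_l ∫ φ
∂^β h_l`, with `φ` in the unit ball of `L^1` and supported in a fixed small ball, are pointwise
bounded on `ℓ^1`. They are then uniformly bounded, and testing on unit vectors bounds `∂^β h_l` at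
the point (`exists_norm_multiDeriv_le`), a contradiction.

For the weighted statement, the first weight condition lets `ν_n(x)` be replaced by a multiple of
`ν_N` on the whole ball around `x`. This gives (a). In (b), one comparison of seminorms is the same
estimate with `P = 1`, and the other integrates the second weight condition, using `ψ_n ∈ L^q`
(`exists_lqNormAt_le`). -/

/-! ### Sup bounds by `L^1` norms of derivatives. -/

section Sobolev

open Function

variable {ι : Type*} [Fintype ι] [DecidableEq ι] {F : Type*} [NormedAddCommGroup F]
  [NormedSpace ℝ F]

/-- A compactly supported `C^1` function is bounded by the integral of its derivative along any
line parallel to a coordinate axis. -/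
lemma enorm_le_lintegral_enorm_fderiv_update {u : (ι → ℝ) → F} (hu : ContDiff ℝ 1 u)
    (h2u : HasCompactSupport u) (x : ι → ℝ) (i : ι) :
    ‖u x‖ₑ ≤ ∫⁻ t : ℝ, ‖fderiv ℝ u (update x i t)‖ₑ := by
  have h1 : ‖u x‖ₑ ≤ ∫⁻ t in Iic (x i), ‖deriv (u ∘ update x i) t‖ₑ := by
    apply le_trans (by simp) (HasCompactSupport.enorm_le_lintegral_Ici_deriv _ _ _)
    · exact hu.comp (by convert! contDiff_update 1 x i)
    · exact h2u.comp_isClosedEmbedding (isClosedEmbedding_update x i)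
  refine h1.trans ?_
  gcongr with y
  · exact Measure.restrict_le_self
  calc ‖deriv (u ∘ update x i) y‖ₑ = ‖fderiv ℝ u (update x i y) (deriv (update x i) y)‖ₑ := by
        rw [fderiv_comp_deriv _ (hu.differentiable one_ne_zero).differentiableAt
          (hasDerivAt_update x i y).differentiableAt]
    _ ≤ ‖fderiv ℝ u (update x i y)‖ₑ * ‖deriv (update x i) y‖ₑ := ContinuousLinearMap.le_opENorm _ _
    _ ≤ ‖fderiv ℝ u (update x i y)‖ₑ := by simp [deriv_update, Pi.enorm_single]

/-- The fundamental theorem of calculus trades one integration, in one coordinate, for one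
derivative. Doing so for each coordinate in `s` raises the order by the size of `s`. -/
lemma enorm_iteratedFDeriv_le_lmarginal {u : (ι → ℝ) → F} (hu : ContDiff ℝ ∞ u)
    (h2u : HasCompactSupport u) (s : Finset ι) (k n : ℕ) (hn : n = k + s.card) (x : ι → ℝ) :
    ‖iteratedFDeriv ℝ k u x‖ₑ ≤
      (∫⋯∫⁻_s, (fun y => ‖iteratedFDeriv ℝ n u y‖ₑ) ∂fun _ => volume) x := by
  induction s using Finset.induction_on generalizing k x with
  | empty =>
    obtain rfl : n = k := by simpa using hn
    simp
  | insert i s hi ih =>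
    rw [Finset.card_insert_of_notMem hi] at hn
    have hc : Continuous (iteratedFDeriv ℝ n u) :=
      hu.continuous_iteratedFDeriv (by exact_mod_cast le_top)
    rw [lmarginal_insert _ hc.enorm.measurable hi]
    refine (enorm_le_lintegral_enorm_fderiv_update
      (hu.iteratedFDeriv_right (m := 1) (i := k) (by exact_mod_cast le_top))
      (h2u.iteratedFDeriv k) x i).trans (lintegral_mono fun t => ?_)
    have h2 : ‖fderiv ℝ (iteratedFDeriv ℝ k u) (update x i t)‖ₑ =
        ‖iteratedFDeriv ℝ (k + 1) u (update x i t)‖ₑ := by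
      rw [← ofReal_norm, ← ofReal_norm, norm_fderiv_iteratedFDeriv]
    rw [h2]
    exact ih (k + 1) (by omega) (update x i t)

/-- The derivatives of a compactly supported smooth function are bounded by the `L^1`-norms of
higher derivatives. -/
theorem enorm_iteratedFDeriv_le_lintegral {u : (ι → ℝ) → F} (hu : ContDiff ℝ ∞ u)
    (h2u : HasCompactSupport u) (k : ℕ) (x : ι → ℝ) :
    ‖iteratedFDeriv ℝ k u x‖ₑ ≤ ∫⁻ y, ‖iteratedFDeriv ℝ (k + Fintype.card ι) u y‖ₑ := by
  have h := enorm_iteratedFDeriv_le_lmarginal hu h2u Finset.univ k _ rfl x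
  rw [lmarginal_univ] at h
  exact h

end Sobolev

namespace WeightedSmooth

/-! ### Partial derivatives as entries of the iterated Fréchet derivative. -/

section PartialDerivatives

open Function

variable {𝕜 : Type*} [RCLike 𝕜] {d : ℕ} {U : Set (Fin d → ℝ)} {f g : (Fin d → ℝ) → 𝕜}

lemma localLinear_pderiv (hU : IsOpen U) (i : Fin d) : LocalLinear (𝕜 := 𝕜) U (pderiv i) :=
  ⟨fun _ hf => contDiffOn_pderiv hU hf i, fun _ _ h => pderiv_congr hU h i,
    fun _ _ hf hg a b => pderiv_lin hU hf hg a b i⟩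

lemma pderiv_comm (hU : IsOpen U) (hf : ContDiffOn ℝ ∞ f U) (i j : Fin d) :
    EqOn (pderiv i (pderiv j f)) (pderiv j (pderiv i f)) U := by
  intro x hx
  have key : ∀ i j : Fin d, pderiv i (pderiv j f) x =
      fderiv ℝ (fderiv ℝ f) x (Pi.single i 1) (Pi.single j 1) := by
    intro i j
    rw [pderiv_congr hU (pderiv_eqOn_fderiv hU hf j) i hx]
    have hd : DifferentiableAt ℝ (fderiv ℝ f) x :=
      ((hf.fderiv_of_isOpen hU (m := ∞) (by simp)).contDiffAt (hU.mem_nhds hx)).differentiableAt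
        (by simp)
    have hd' := hd.clm_apply (differentiableAt_const (Pi.single j (1 : ℝ) : Fin d → ℝ))
    rw [pderiv, hd'.lineDeriv_eq_fderiv]
    rw [fderiv_clm_apply hd (differentiableAt_const _)]
    simp
  rw [key, key]
  have hs : IsSymmSndFDerivAt ℝ f x := by
    refine (hf.contDiffAt (hU.mem_nhds hx)).isSymmSndFDerivAt ?_
    rw [minSmoothness_of_isRCLikeNormedField]
    exact WithTop.coe_le_coe.2 (le_top : (2 : ℕ∞) ≤ ⊤)
  exact hs.eq _ _

lemma pderiv_iterate_comm (hU : IsOpen U) (hf : ContDiffOn ℝ ∞ f U) (i j : Fin d) (n : ℕ) :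
    EqOn (pderiv i ((pderiv j)^[n] f)) ((pderiv j)^[n] (pderiv i f)) U := by
  induction n generalizing f with
  | zero => exact fun _ _ => rfl
  | succ n ih =>
    exact (ih (contDiffOn_pderiv hU hf j)).trans
      (((localLinear_pderiv hU j).iterate n).congr _ _ (pderiv_comm hU hf i j))

/-- `multiDeriv` takes the partial derivatives in a fixed order, so the extra one has to be commuted
to its place, which is allowed by the symmetry of second derivatives. -/
lemma pderiv_multiDeriv (hU : IsOpen U) (hf : ContDiffOn ℝ ∞ f U) (i : Fin d) (α : Fin d →₀ ℕ) :
    EqOn (pderiv i (multiDeriv α f)) (multiDeriv (α + Finsupp.single i 1) f) U := by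
  -- The induction records whether `i` has already occurred in the list; absence of duplicates
  -- ensures that its exponent is raised exactly once.
  have aux : ∀ l : List (Fin d), l.Nodup → ContDiffOn ℝ ∞
      (l.foldr (fun i g => (pderiv i)^[α i] g) f) U ∧
      (i ∉ l → l.foldr (fun j g => (pderiv j)^[(α + Finsupp.single i 1 : Fin d →₀ ℕ) j] g) f =
        l.foldr (fun j g => (pderiv j)^[α j] g) f) ∧
      (i ∈ l → EqOn (pderiv i (l.foldr (fun j g => (pderiv j)^[α j] g) f))
        (l.foldr (fun j g => (pderiv j)^[(α + Finsupp.single i 1 : Fin d →₀ ℕ) j] g) f) U) := by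
    intro l
    induction l with
    | nil => exact fun _ => ⟨hf, by simp, by simp⟩
    | cons j l ih =>
      intro hl
      rw [List.nodup_cons] at hl
      obtain ⟨h1, h2, h3⟩ := ih hl.2
      refine ⟨((localLinear_pderiv hU j).iterate _).smooth _ h1, fun hi => ?_, fun hi => ?_⟩
      · rw [List.mem_cons, not_or] at hi
        rw [List.foldr_cons, List.foldr_cons, h2 hi.2]
        simp [hi.1]
      · rw [List.foldr_cons, List.foldr_cons]
        by_cases hij : i = j
        · subst hij
          rw [h2 hl.1]
          have : (α + Finsupp.single i 1 : Fin d →₀ ℕ) i = α i + 1 := by simp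
          rw [this, iterate_succ_apply']
          exact fun _ _ => rfl
        · have hil : i ∈ l := (List.mem_cons.1 hi).resolve_left hij
          have : (α + Finsupp.single i 1 : Fin d →₀ ℕ) j = α j := by simp [hij]
          rw [this]
          exact (pderiv_iterate_comm hU h1 i j _).trans
            (((localLinear_pderiv hU j).iterate _).congr _ _ (h3 hil))
  exact (aux _ (List.nodup_finRange d)).2.2 (List.mem_finRange i)

lemma multiDeriv_zero (f : (Fin d → ℝ) → 𝕜) : multiDeriv 0 f = f := by
  unfold multiDeriv
  induction List.finRange d with
  | nil => rfl
  | cons i l ih => rw [List.foldr_cons, ih]; rfl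

lemma order_add (α β : Fin d →₀ ℕ) : order (α + β) = order α + order β := by
  simp [order, Finset.sum_add_distrib]

lemma order_single (i : Fin d) : order (Finsupp.single i 1) = 1 := by
  simp [order, Finsupp.single_apply]

/-- Evaluated at unit vectors, the iterated derivative is an iterated partial derivative. -/
lemma exists_iteratedFDeriv_apply_eq_multiDeriv (hU : IsOpen U) (k : ℕ) (w : Fin k → Fin d) :
    ∃ α : Fin d →₀ ℕ, order α = k ∧ ∀ f : (Fin d → ℝ) → 𝕜, ContDiffOn ℝ ∞ f U →
      EqOn (fun x => iteratedFDeriv ℝ k f x fun j => Pi.single (w j) 1) (multiDeriv α f) U := by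
  induction k with
  | zero => exact ⟨0, by simp [order], fun f _ x _ => by simp [multiDeriv_zero]⟩
  | succ k ih =>
    obtain ⟨α, hα, h⟩ := ih (fun j => w j.succ)
    refine ⟨α + Finsupp.single (w 0) 1, by rw [order_add, hα, order_single], fun f hf x hx => ?_⟩
    rw [← pderiv_multiDeriv hU hf (w 0) α hx, ← pderiv_congr hU (h f hf) (w 0) hx]
    have hd : DifferentiableAt ℝ (iteratedFDeriv ℝ k f) x :=
      ((hf.contDiffAt (hU.mem_nhds hx)).iteratedFDeriv_right (m := 1) (i := k)
        (by exact_mod_cast le_top)).differentiableAt one_ne_zero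
    have hd' := hd.hasFDerivAt.continuousMultilinear_apply_const
      (fun j : Fin k => (Pi.single (w j.succ) 1 : Fin d → ℝ))
    rw [pderiv, hd'.differentiableAt.lineDeriv_eq_fderiv, hd'.fderiv]
    simp only [iteratedFDeriv_succ_apply_left]
    rfl

end PartialDerivatives

/-! ### Sobolev inequality with a cutoff. -/

section SobolevEstimate

variable {𝕜 : Type*} [RCLike 𝕜] {d : ℕ} {U : Set (Fin d → ℝ)}

/-- Expand every argument in the standard basis. Coordinates are bounded by the sup norm, so no
constant appears. -/
lemma exists_norm_iteratedFDeriv_le_sum (hU : IsOpen U) (k : ℕ) :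
    ∃ a : (Fin k → Fin d) → (Fin d →₀ ℕ), (∀ w, order (a w) = k) ∧
      ∀ f : (Fin d → ℝ) → 𝕜, ContDiffOn ℝ ∞ f U → ∀ x ∈ U,
        ‖iteratedFDeriv ℝ k f x‖ ≤ ∑ w, ‖multiDeriv (a w) f x‖ := by
  choose a ha h using exists_iteratedFDeriv_apply_eq_multiDeriv (𝕜 := 𝕜) hU k
  refine ⟨a, ha, fun f hf x hx => ?_⟩
  refine ContinuousMultilinearMap.opNorm_le_bound (Finset.sum_nonneg fun _ _ => norm_nonneg _)
    fun v => ?_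
  have hv : v = fun j => ∑ i, v j i • (Pi.single i 1 : Fin d → ℝ) := by
    funext j
    exact pi_eq_sum_univ' (v j)
  conv_lhs => rw [hv]
  rw [ContinuousMultilinearMap.map_sum, Finset.sum_mul]
  refine (norm_sum_le _ _).trans (Finset.sum_le_sum fun w _ => ?_)
  rw [ContinuousMultilinearMap.map_smul_univ, norm_smul, mul_comm, norm_prod, ← h w f hf hx]
  gcongr with j
  exact norm_le_pi_norm (v j) (w j)

lemma eLpNorm_multiDeriv_le_lqNorm (q : ℕ) (w : (Fin d → ℝ) → ℝ) {m : ℕ}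
    (f : (Fin d → ℝ) → 𝕜) {α : Fin d →₀ ℕ} (hα : order α ≤ m) :
    eLpNorm (fun x => w x • multiDeriv α f x) q (volume.restrict U) ≤ lqNorm q U w m f :=
  le_iSup₂_of_le (f := fun (α : Fin d →₀ ℕ) (_ : order α ≤ m) =>
    eLpNorm (fun x => w x • multiDeriv α f x) (q : ℝ≥0∞) (volume.restrict U)) α hα le_rfl

lemma lqNorm_mono (q : ℕ) (w : (Fin d → ℝ) → ℝ) {m n : ℕ} (h : m ≤ n)
    (f : (Fin d → ℝ) → 𝕜) : lqNorm q U w m f ≤ lqNorm q U w n f :=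
  iSup₂_le fun _ hα => eLpNorm_multiDeriv_le_lqNorm q w f (hα.trans h)

/-- On sets of finite measure the `L^1`-norm is bounded by the `L^q`-norm. -/
lemma exists_lintegral_enorm_le_eLpNorm {q : ℕ} (hq : 0 < q) (hvol : volume U ≠ ⊤) :
    ∃ C : ℝ≥0, ∀ f : (Fin d → ℝ) → 𝕜, AEStronglyMeasurable f (volume.restrict U) →
      ∫⁻ x in U, ‖f x‖ₑ ≤ C * eLpNorm f q (volume.restrict U) := by
  have hfin : (volume.restrict U) univ ^ (1 / (1 : ℝ≥0∞).toReal - 1 / (q : ℝ≥0∞).toReal) ≠ ⊤ := by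
    refine ENNReal.rpow_ne_top_of_nonneg ?_ (by simpa using hvol)
    have : (1 : ℝ) ≤ q := by exact_mod_cast hq
    simpa using inv_le_one_of_one_le₀ this
  refine ⟨ENNReal.toNNReal ((volume.restrict U) univ ^
    (1 / (1 : ℝ≥0∞).toReal - 1 / (q : ℝ≥0∞).toReal)), fun f hf => ?_⟩
  rw [← eLpNorm_one_eq_lintegral_enorm, ENNReal.coe_toNNReal hfin, mul_comm]
  exact eLpNorm_le_eLpNorm_mul_rpow_measure_univ (by exact_mod_cast hq) hf

lemma exists_lintegral_iteratedFDeriv_le_lqNorm {q : ℕ} (hq : 0 < q) (hU : IsOpen U)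
    (hvol : volume U ≠ ⊤) (k : ℕ) :
    ∃ C : ℝ≥0, ∀ f : (Fin d → ℝ) → 𝕜, ContDiffOn ℝ ∞ f U →
      ∫⁻ x in U, ‖iteratedFDeriv ℝ k f x‖ₑ ≤ C * lqNorm q U (fun _ => 1) k f := by
  obtain ⟨C, hC⟩ := exists_lintegral_enorm_le_eLpNorm (𝕜 := 𝕜) hq hvol
  obtain ⟨a, ha, h⟩ := exists_norm_iteratedFDeriv_le_sum (𝕜 := 𝕜) hU k
  refine ⟨∑ _w : Fin k → Fin d, C, fun f hf => ?_⟩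
  have hc : ∀ α, ContinuousOn (multiDeriv α f) U := fun α =>
    ((localLinear_multiDeriv hU α).smooth f hf).continuousOn
  calc ∫⁻ x in U, ‖iteratedFDeriv ℝ k f x‖ₑ
      ≤ ∫⁻ x in U, ∑ w, ‖multiDeriv (a w) f x‖ₑ := by
        refine setLIntegral_mono' hU.measurableSet fun x hx => ?_
        rw [← ofReal_norm]
        refine (ENNReal.ofReal_le_ofReal (h f hf x hx)).trans_eq ?_
        rw [ENNReal.ofReal_sum_of_nonneg fun _ _ => norm_nonneg _]
        simp only [ofReal_norm]
    _ = ∑ w, ∫⁻ x in U, ‖multiDeriv (a w) f x‖ₑ :=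
        lintegral_finsetSum' _ fun w _ =>
          ((hc (a w)).aestronglyMeasurable hU.measurableSet).enorm
    _ ≤ ∑ _w : Fin k → Fin d, C * lqNorm q U (fun _ => 1) k f := by
        refine Finset.sum_le_sum fun w _ => (hC _ ((hc (a w)).aestronglyMeasurable
          hU.measurableSet)).trans ?_
        gcongr
        simpa using eLpNorm_multiDeriv_le_lqNorm (U := U) q (fun _ => 1) f (ha w).le
    _ = (∑ _w : Fin k → Fin d, C : ℝ≥0) * lqNorm q U (fun _ => 1) k f := by
        rw [← Finset.sum_mul]
        push_cast
        rfl

lemma contDiff_smul_of_tsupport_subset (hU : IsOpen U) {χ : (Fin d → ℝ) → ℝ}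
    (hχ : ContDiff ℝ ∞ χ) (hsupp : tsupport χ ⊆ U) {f : (Fin d → ℝ) → 𝕜}
    (hf : ContDiffOn ℝ ∞ f U) : ContDiff ℝ ∞ (fun x => χ x • f x) := by
  refine contDiff_iff_contDiffAt.2 fun x => ?_
  by_cases hx : x ∈ tsupport χ
  · exact hχ.contDiffAt.smul (hf.contDiffAt (hU.mem_nhds (hsupp hx)))
  · refine (contDiffAt_const (c := (0 : 𝕜))).congr_of_eventuallyEq ?_
    filter_upwards [(isClosed_tsupport χ).isOpen_compl.mem_nhds hx] with y hy
    rw [image_eq_zero_of_notMem_tsupport hy, zero_smul]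

/-- **Sobolev inequality**: the derivatives of a smooth function, cut off to a compact subset of
`U`, are bounded by the `L^q`-norms of its derivatives on `U`. -/
theorem exists_enorm_iteratedFDeriv_smul_le_lqNorm {q : ℕ} (hq : 0 < q) (hU : IsOpen U)
    (hvol : volume U ≠ ⊤) {χ : (Fin d → ℝ) → ℝ} (hχ : ContDiff ℝ ∞ χ)
    (hcomp : HasCompactSupport χ) (hsupp : tsupport χ ⊆ U) (k : ℕ) :
    ∃ C : ℝ≥0, ∀ f : (Fin d → ℝ) → 𝕜, ContDiffOn ℝ ∞ f U → ∀ x,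
      ‖iteratedFDeriv ℝ k (fun x => χ x • f x) x‖ₑ ≤ C * lqNorm q U (fun _ => 1) (k + d) f := by
  choose C hC using exists_lintegral_iteratedFDeriv_le_lqNorm (𝕜 := 𝕜) hq hU hvol
  have hB : ∀ i, ∃ B : ℝ≥0, ∀ x, ‖iteratedFDeriv ℝ i χ x‖ ≤ B := fun i => by
    obtain ⟨B, hB⟩ := (hcomp.iteratedFDeriv (𝕜 := ℝ) i).exists_bound_of_continuous
      (hχ.continuous_iteratedFDeriv (by exact_mod_cast le_top))
    exact ⟨B.toNNReal, fun x => (hB x).trans (Real.le_coe_toNNReal B)⟩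
  choose B hB using hB
  -- One additional derivative for each of the `d` integrations. The constant below collects the
  -- Leibniz coefficients, the bounds on the derivatives of `χ` and the `L^1`-`L^q` constants.
  set n := k + d with hn
  refine ⟨∑ i ∈ Finset.range (n + 1), n.choose i * B i * C (n - i), fun f hf x => ?_⟩
  set u : (Fin d → ℝ) → 𝕜 := fun x => χ x • f x with hu
  have hus : ContDiff ℝ ∞ u := contDiff_smul_of_tsupport_subset hU hχ hsupp hf
  have huc : HasCompactSupport u := hcomp.smul_right
  have hle := enorm_iteratedFDeriv_le_lintegral hus huc k x
  rw [Fintype.card_fin, ← hn] at hle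
  have hbd : ∀ y ∈ U, ‖iteratedFDeriv ℝ n u y‖ₑ ≤ ∑ i ∈ Finset.range (n + 1),
      ((n.choose i * B i : ℝ≥0) : ℝ≥0∞) * ‖iteratedFDeriv ℝ (n - i) f y‖ₑ := by
    intro y hy
    have h1 := norm_iteratedFDerivWithin_smul_le (n := n) hχ.contDiffOn hf hU.uniqueDiffOn hy
      (by exact_mod_cast le_top)
    simp only [iteratedFDerivWithin_of_isOpen _ hU hy] at h1
    rw [← ofReal_norm]
    refine (ENNReal.ofReal_le_ofReal h1).trans ?_
    rw [ENNReal.ofReal_sum_of_nonneg fun _ _ => by positivity]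
    refine Finset.sum_le_sum fun i _ => ?_
    rw [ENNReal.ofReal_mul (by positivity), ofReal_norm]
    gcongr
    rw [← ENNReal.ofReal_coe_nnreal]
    push_cast
    gcongr
    exact hB i y
  calc ‖iteratedFDeriv ℝ k u x‖ₑ ≤ ∫⁻ y, ‖iteratedFDeriv ℝ n u y‖ₑ := hle
    _ = ∫⁻ y in U, ‖iteratedFDeriv ℝ n u y‖ₑ := by
        refine (setLIntegral_eq_of_support_subset fun y hy => ?_).symm
        have h1 : y ∈ tsupport u :=
          support_iteratedFDeriv_subset (𝕜 := ℝ) n fun h => hy (by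
            show ‖_‖ₑ = 0; rw [← ofReal_norm, h, norm_zero, ENNReal.ofReal_zero])
        exact hsupp (tsupport_smul_subset_left χ f h1)
    _ ≤ ∫⁻ y in U, ∑ i ∈ Finset.range (n + 1),
        ((n.choose i * B i : ℝ≥0) : ℝ≥0∞) * ‖iteratedFDeriv ℝ (n - i) f y‖ₑ :=
        setLIntegral_mono' hU.measurableSet hbd
    _ = ∑ i ∈ Finset.range (n + 1),
        ((n.choose i * B i : ℝ≥0) : ℝ≥0∞) * ∫⁻ y in U, ‖iteratedFDeriv ℝ (n - i) f y‖ₑ := by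
        have hm : ∀ i, AEMeasurable (fun y => ‖iteratedFDeriv ℝ i f y‖ₑ) (volume.restrict U) :=
          fun i => by
            have h1 : ContinuousOn (iteratedFDeriv ℝ i f) U :=
              (hf.continuousOn_iteratedFDerivWithin (by exact_mod_cast le_top)
                hU.uniqueDiffOn).congr fun y hy => (iteratedFDerivWithin_of_isOpen i hU hy).symm
            exact (h1.aestronglyMeasurable hU.measurableSet).enorm
        rw [lintegral_finsetSum' _ fun i _ => (hm (n - i)).const_mul _]
        exact Finset.sum_congr rfl fun i _ => lintegral_const_mul'' _ (hm (n - i))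
    _ ≤ ∑ i ∈ Finset.range (n + 1),
        ((n.choose i * B i : ℝ≥0) : ℝ≥0∞) * (C (n - i) * lqNorm q U (fun _ => 1) n f) := by
        gcongr with i hi
        refine (hC (n - i) f hf).trans ?_
        gcongr
        exact lqNorm_mono q _ (Nat.sub_le n i) f
    _ = _ := by
        push_cast
        rw [Finset.sum_mul]
        exact Finset.sum_congr rfl fun i _ => by ring

end SobolevEstimate

/-! ### Regular distributions and their derivatives. -/

section Distributions

variable {𝕜 : Type*} [RCLike 𝕜] {d : ℕ}

section RegularDistributions

variable {U : Opens (Fin d → ℝ)} {g : (Fin d → ℝ) → 𝕜}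

lemma integrable_smul_of_locallyIntegrableOn (hg : LocallyIntegrableOn g U) (φ : 𝓓(U, ℝ)) :
    Integrable fun x => φ x • g x :=
  TestFunction.integrable_bilin (𝕜 := ℝ) (ContinuousLinearMap.lsmul ℝ ℝ) hg φ

lemma integrable_smul_of_contDiffOn (hg : ContDiffOn ℝ ∞ g U) (φ : 𝓓(U, ℝ)) :
    Integrable fun x => φ x • g x :=
  integrable_smul_of_locallyIntegrableOn (hg.continuousOn.locallyIntegrableOn
    U.isOpen.measurableSet) φ

/-- Locally integrable functions define distributions. -/
lemma exists_distribution_of_locallyIntegrableOn (hg : LocallyIntegrableOn g U) :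
    ∃ T : 𝓓'(U, 𝕜), ∀ φ, T φ = ∫ x, φ x • g x := by
  refine ⟨UniformConvergenceCLM.ofFun _ _ _
    (TestFunction.integralAgainstBilinCLM (ContinuousLinearMap.lsmul ℝ ℝ) volume g), fun φ => ?_⟩
  exact TestFunction.integralAgainstBilinCLM_eq_integral hg

/-- Integration by parts, where the compact support of `φ` removes boundary terms. As `g` is smooth
only on `U`, its differentiability is used only on the support of `φ`. -/
lemma lineDeriv_distribution_apply_of_contDiffOn (hg : ContDiffOn ℝ ∞ g U) {T : 𝓓'(U, 𝕜)}
    (hT : ∀ φ, T φ = ∫ x, φ x • g x) (i : Fin d) (φ : 𝓓(U, ℝ)) :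
    (∂_{(Pi.single i 1 : Fin d → ℝ)} T) φ = ∫ x, φ x • pderiv i g x := by
  have hd : ∀ x, (∂_{(Pi.single i 1 : Fin d → ℝ)} φ) x = lineDeriv ℝ φ x (Pi.single i 1) :=
    fun x => TestFunction.lineDerivCLM_apply_of_le le_top
  have hφ : Differentiable ℝ φ := φ.contDiff.differentiable (by simp)
  rw [Distribution.lineDerivOp_apply_apply, map_neg, hT]
  have h := integral_bilinear_hasLineDerivAt_right_eq_neg_left_of_integrable (μ := volume)
    (f := φ) (f' := fun x => lineDeriv ℝ φ x (Pi.single i 1)) (g := g) (g' := pderiv i g)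
    (v := Pi.single i 1) (B := ContinuousLinearMap.lsmul ℝ ℝ) ?_
    (integrable_smul_of_contDiffOn (contDiffOn_pderiv U.isOpen hg i) φ)
    (integrable_smul_of_contDiffOn hg φ)
    (fun x _ => (hφ x).lineDifferentiableAt.hasLineDerivAt)
    (fun x hx => ((hg.contDiffAt (U.isOpen.mem_nhds (φ.tsupport_subset hx))).differentiableAt
      (by simp)).lineDifferentiableAt.hasLineDerivAt)
  · simp only [ContinuousLinearMap.lsmul_apply] at h
    rw [h]
    simp only [hd]
  · have := integrable_smul_of_contDiffOn hg (∂_{(Pi.single i 1 : Fin d → ℝ)} φ)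
    simp only [hd] at this
    exact this

lemma distMultiDeriv_apply_of_contDiffOn (hg : ContDiffOn ℝ ∞ g U) {T : 𝓓'(U, 𝕜)}
    (hT : ∀ φ, T φ = ∫ x, φ x • g x) (α : Fin d →₀ ℕ) (φ : 𝓓(U, ℝ)) :
    distMultiDeriv α T φ = ∫ x, φ x • multiDeriv α g x := by
  have hit : ∀ (i : Fin d) (n : ℕ) (S : 𝓓'(U, 𝕜)) (f : (Fin d → ℝ) → 𝕜), ContDiffOn ℝ ∞ f U →
      (∀ φ, S φ = ∫ x, φ x • f x) → ContDiffOn ℝ ∞ ((pderiv i)^[n] f) U ∧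
      ∀ φ, ((fun R : 𝓓'(U, 𝕜) => ∂_{(Pi.single i 1 : Fin d → ℝ)} R)^[n] S) φ =
        ∫ x, φ x • (pderiv i)^[n] f x := by
    intro i n
    induction n with
    | zero => exact fun S f hf h => ⟨hf, h⟩
    | succ n ih =>
      exact fun S f hf h => ih _ _ (contDiffOn_pderiv U.isOpen hf i)
        (lineDeriv_distribution_apply_of_contDiffOn hf h i)
  suffices h : ∀ l : List (Fin d),
      ContDiffOn ℝ ∞ (l.foldr (fun i g => (pderiv i)^[α i] g) g) U ∧
      ∀ φ, (l.foldr (fun i S => (fun R : 𝓓'(U, 𝕜) =>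
        ∂_{(Pi.single i 1 : Fin d → ℝ)} R)^[α i] S) T) φ =
        ∫ x, φ x • l.foldr (fun i g => (pderiv i)^[α i] g) g x from (h _).2 φ
  intro l
  induction l with
  | nil => exact ⟨hg, hT⟩
  | cons i l ih => exact hit i _ _ _ ih.1 ih.2

/-- The transpose of `∂^α`. -/
lemma exists_distMultiDeriv_apply_eq (α : Fin d →₀ ℕ) (φ : 𝓓(U, ℝ)) :
    ∃ ψ : 𝓓(U, ℝ), ∀ T : 𝓓'(U, 𝕜), distMultiDeriv α T φ = T ψ := by
  have hit : ∀ (i : Fin d) (n : ℕ) (φ : 𝓓(U, ℝ)), ∃ ψ : 𝓓(U, ℝ), ∀ T : 𝓓'(U, 𝕜),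
      ((fun R : 𝓓'(U, 𝕜) => ∂_{(Pi.single i 1 : Fin d → ℝ)} R)^[n] T) φ = T ψ := by
    intro i n φ
    induction n with
    | zero => exact ⟨φ, fun T => rfl⟩
    | succ n ih =>
      obtain ⟨ψ, hψ⟩ := ih
      exact ⟨- ∂_{(Pi.single i 1 : Fin d → ℝ)} ψ, fun T => (hψ _).trans
        (Distribution.lineDerivOp_apply_apply _ _ _)⟩
  unfold distMultiDeriv
  induction List.finRange d generalizing φ with
  | nil => exact ⟨φ, fun T => rfl⟩
  | cons i l ih =>
    obtain ⟨ψ, hψ⟩ := hit i (α i) φ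
    obtain ⟨ψ', hψ'⟩ := ih ψ
    exact ⟨ψ', fun T => (hψ _).trans (hψ' T)⟩

lemma distDiffOp_apply (P : MvPolynomial (Fin d) 𝕜) (T : 𝓓'(U, 𝕜)) (φ : 𝓓(U, ℝ)) :
    distDiffOp P T φ = ∑ α ∈ P.support, P.coeff α * distMultiDeriv α T φ := by
  unfold distDiffOp
  induction P.support using Finset.induction_on with
  | empty => simp
  | insert a s ha ih =>
    rw [Finset.sum_insert ha, Finset.sum_insert ha, ← ih]
    rfl

lemma contDiffOn_diffOp {V : Set (Fin d → ℝ)} (hV : IsOpen V) (P : MvPolynomial (Fin d) 𝕜)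
    (hg : ContDiffOn ℝ ∞ g V) : ContDiffOn ℝ ∞ (diffOp P g) V :=
  ContDiffOn.sum fun α _ => contDiffOn_const.mul ((localLinear_multiDeriv hV α).smooth g hg)

lemma distDiffOp_apply_of_contDiffOn (P : MvPolynomial (Fin d) 𝕜) (hg : ContDiffOn ℝ ∞ g U)
    {T : 𝓓'(U, 𝕜)} (hT : ∀ φ, T φ = ∫ x, φ x • g x) (φ : 𝓓(U, ℝ)) :
    distDiffOp P T φ = ∫ x, φ x • diffOp P g x := by
  rw [distDiffOp_apply]
  simp only [distMultiDeriv_apply_of_contDiffOn hg hT, diffOp, Finset.smul_sum]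
  rw [integral_finsetSum]
  · refine Finset.sum_congr rfl fun α _ => ?_
    rw [← integral_const_mul]
    simp only [mul_smul_comm]
  · intro α _
    have := (integrable_smul_of_contDiffOn
      ((localLinear_multiDeriv U.isOpen α).smooth g hg) φ).const_mul (P.coeff α)
    simpa only [mul_smul_comm] using this

end RegularDistributions

end Distributions

/-! ### Smoothness of absolutely convergent series. -/

section SeriesOfSolutions

variable {𝕜 : Type*} [RCLike 𝕜] {d : ℕ}

section Series

variable {U V : Opens (Fin d → ℝ)} {c : ℕ → 𝕜} {B : ℝ≥0} {h : ℕ → (Fin d → ℝ) → 𝕜}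

lemma tsum_lintegral_enorm_mul_ne_top {X : Type*} [MeasurableSpace X] {μ : Measure X}
    {h : ℕ → X → 𝕜} (hc : Summable fun l => ‖c l‖) (hB : ∀ l, ∫⁻ x, ‖h l x‖ₑ ∂μ ≤ B) :
    ∑' l, ∫⁻ x, ‖c l * h l x‖ₑ ∂μ ≠ ⊤ := by
  have h1 : ∑' l, ‖c l‖ₑ ≠ ⊤ :=
    ENNReal.tsum_coe_ne_top_iff_summable.2 (NNReal.summable_coe.1 (by simpa using hc))
  refine ne_top_of_le_ne_top (ENNReal.mul_ne_top h1 (ENNReal.coe_ne_top (r := B))) ?_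
  rw [← ENNReal.tsum_mul_right]
  refine ENNReal.tsum_le_tsum fun l => ?_
  simp only [enorm_mul]
  rw [lintegral_const_mul' _ _ enorm_ne_top]
  gcongr
  exact hB l

lemma integrable_tsum_mul {X : Type*} [MeasurableSpace X] {μ : Measure X}
    {h : ℕ → X → 𝕜} (hm : ∀ l, AEStronglyMeasurable (h l) μ)
    (hc : Summable fun l => ‖c l‖) (hB : ∀ l, ∫⁻ x, ‖h l x‖ₑ ∂μ ≤ B) :
    Integrable (fun x => ∑' l, c l * h l x) μ := by
  have hm' : ∀ l, AEMeasurable (fun x => c l * h l x) μ := fun l =>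
    ((hm l).const_mul (c l)).aemeasurable
  refine ⟨(AEMeasurable.tsum hm').aestronglyMeasurable, ?_⟩
  refine lt_of_le_of_lt ?_ (tsum_lintegral_enorm_mul_ne_top hc hB).lt_top
  rw [← lintegral_tsum fun l => (hm' l).enorm]
  -- At points where the series diverges `tsum` is `0`, so the bound still holds.
  exact lintegral_mono fun x => enorm_tsum_le_tsum_enorm

/-- A series with absolutely summable coefficients and terms bounded in `L^1` may be integrated
against test functions termwise. -/
lemma hasSum_integral_smul_tsum (hm : ∀ l, AEStronglyMeasurable (h l) (volume.restrict V))
    (hc : Summable fun l => ‖c l‖) (hB : ∀ l, ∫⁻ x in V, ‖h l x‖ₑ ≤ B) (φ : 𝓓(V, ℝ)) :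
    HasSum (fun l => c l * ∫ x, φ x • h l x) (∫ x, φ x • ∑' l, c l * h l x) := by
  have hφ : ∀ f : (Fin d → ℝ) → 𝕜, ∫ x, φ x • f x = ∫ x in V, φ x • f x := fun f =>
    (setIntegral_eq_integral_of_forall_compl_eq_zero fun x hx => by
      rw [image_eq_zero_of_notMem_tsupport fun h => hx (φ.tsupport_subset h), zero_smul]).symm
  obtain ⟨C, hC⟩ := φ.hasCompactSupport.exists_bound_of_continuous φ.continuous
  simp only [hφ]
  have hi : ∀ l, Integrable (h l) (volume.restrict V) := fun l =>
    ⟨hm l, (hB l).trans_lt ENNReal.coe_lt_top⟩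
  have hi' : ∀ l, Integrable (fun x => φ x • (c l * h l x)) (volume.restrict V) := fun l =>
    ((hi l).const_mul (c l)).bdd_smul C φ.continuous.aestronglyMeasurable
      (ae_of_all _ hC)
  have hn : ∀ l, ∫ x in V, ‖h l x‖ ≤ B := fun l => by
    rw [integral_norm_eq_lintegral_enorm (hm l)]
    exact ENNReal.toReal_le_coe_of_le_coe (hB l)
  have hs : Summable fun l => ∫ x in V, ‖φ x • (c l * h l x)‖ := by
    refine Summable.of_nonneg_of_le (fun l => integral_nonneg fun x => norm_nonneg _)
      (fun l => ?_) (hc.mul_left (C * B))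
    have h1 : ∀ x, ‖φ x • (c l * h l x)‖ ≤ C * ‖c l‖ * ‖h l x‖ := fun x => by
      rw [norm_smul, norm_mul, ← mul_assoc]
      gcongr
      exact hC x
    refine (integral_mono (hi' l).norm ((hi l).norm.const_mul _) h1).trans ?_
    rw [integral_const_mul]
    have hC0 : 0 ≤ C := (norm_nonneg _).trans (hC 0)
    calc C * ‖c l‖ * ∫ x in V, ‖h l x‖ ≤ C * ‖c l‖ * B := by gcongr; exact hn l
      _ = C * B * ‖c l‖ := by ring
  have := hasSum_integral_of_summable_integral_norm hi' hs
  simp only [← mul_smul_comm, integral_const_mul] at this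
  simpa only [← tsum_const_smul'', mul_smul_comm] using this

/-- Absolutely convergent series of smooth functions, bounded in `L^1(U)`, whose images under a
hypoelliptic operator are bounded in all Sobolev norms on `U`, converge to a smooth function on
smaller open sets, in the sense of distributions. -/
theorem exists_contDiffOn_hasSum_integral {P : MvPolynomial (Fin d) 𝕜} (hP : IsHypoelliptic P)
    {q : ℕ} (hq : 0 < q) (hvol : volume (U : Set (Fin d → ℝ)) ≠ ⊤) (hVU : V ≤ U)
    {χ : (Fin d → ℝ) → ℝ} (hχ : ContDiff ℝ ∞ χ) (hcomp : HasCompactSupport χ)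
    (hsupp : tsupport χ ⊆ U) (hone : ∀ x ∈ V, χ x = 1)
    (hs : ∀ l, ContDiffOn ℝ ∞ (h l) U) (hB : ∀ l, ∫⁻ x in U, ‖h l x‖ₑ ≤ B)
    (hM : ∀ k, ∃ M : ℝ≥0, ∀ l, lqNorm q U (fun _ => 1) k (diffOp P (h l)) ≤ M)
    (hc : Summable fun l => ‖c l‖) :
    ∃ g : (Fin d → ℝ) → 𝕜, ContDiffOn ℝ ∞ g V ∧ ∀ (α : Fin d →₀ ℕ) (φ : 𝓓(V, ℝ)),
      HasSum (fun l => c l * ∫ x, φ x • multiDeriv α (h l) x) (∫ x, φ x • multiDeriv α g x) := by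
  have hsV : ∀ l, ContDiffOn ℝ ∞ (h l) V := fun l => (hs l).mono hVU
  have hmV : ∀ l, AEStronglyMeasurable (h l) (volume.restrict V) := fun l =>
    (hsV l).continuousOn.aestronglyMeasurable V.isOpen.measurableSet
  have hBV : ∀ l, ∫⁻ x in V, ‖h l x‖ₑ ≤ B := fun l => (lintegral_mono_set hVU).trans (hB l)
  have hF := hasSum_integral_smul_tsum hmV hc hBV
  obtain ⟨T, hT⟩ := exists_distribution_of_locallyIntegrableOn
    (IntegrableOn.locallyIntegrableOn (integrable_tsum_mul hmV hc hBV) :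
      LocallyIntegrableOn (fun x => ∑' l, c l * h l x) V)
  choose S hS using fun l => exists_distribution_of_locallyIntegrableOn
    ((hsV l).continuousOn.locallyIntegrableOn V.isOpen.measurableSet)
  have hTS : ∀ φ, HasSum (fun l => c l * S l φ) (T φ) := fun φ => by
    simpa only [hT, hS] using hF φ
  -- Weak convergence passes to derivatives without any estimate, since the derivative moves to the
  -- test function.
  have hTSα : ∀ α φ, HasSum (fun l => c l * distMultiDeriv α (S l) φ) (distMultiDeriv α T φ) := by
    intro α φ
    obtain ⟨ψ, hψ⟩ := exists_distMultiDeriv_apply_eq (𝕜 := 𝕜) α φ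
    simpa only [hψ] using hTS ψ
  have hTSP : ∀ φ, HasSum (fun l => c l * distDiffOp P (S l) φ) (distDiffOp P T φ) := by
    intro φ
    simp only [distDiffOp_apply, Finset.mul_sum]
    refine hasSum_sum fun α _ => ?_
    have := (hTSα α φ).mul_left (P.coeff α)
    simpa only [mul_left_comm] using this
  have hPs : ∀ l, ContDiffOn ℝ ∞ (diffOp P (h l)) U := fun l => contDiffOn_diffOp U.isOpen P (hs l)
  -- The cutoff leaves `P(∂) h_l` unchanged on `V` and makes its derivatives globally bounded,
  -- uniformly in `l`, as the M-test requires.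
  set G : ℕ → (Fin d → ℝ) → 𝕜 := fun l x => χ x • diffOp P (h l) x with hG
  have hGs : ∀ l, ContDiff ℝ ∞ (G l) := fun l =>
    contDiff_smul_of_tsupport_subset U.isOpen hχ hsupp (hPs l)
  have hA : ∀ k, ∃ A : ℝ≥0, ∀ l x, ‖iteratedFDeriv ℝ k (G l) x‖ ≤ A := by
    intro k
    obtain ⟨C, hC⟩ := exists_enorm_iteratedFDeriv_smul_le_lqNorm (𝕜 := 𝕜) hq U.isOpen hvol hχ
      hcomp hsupp k
    obtain ⟨M, hM⟩ := hM (k + d)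
    refine ⟨C * M, fun l x => ?_⟩
    have h1 : ‖iteratedFDeriv ℝ k (G l) x‖ₑ ≤ ((C * M : ℝ≥0) : ℝ≥0∞) := by
      refine (hC _ (hPs l) x).trans ?_
      push_cast
      gcongr
      exact hM l
    exact_mod_cast (ENNReal.coe_le_coe.1 h1)
  choose A hA using hA
  have hsmooth : ContDiff ℝ ∞ fun x => ∑' l, c l * G l x := by
    refine contDiff_tsum (v := fun k l => ‖c l‖ * A k) (fun l => contDiff_const.mul (hGs l))
      (fun k _ => hc.mul_right _) fun k l x _ => ?_
    have : iteratedFDeriv ℝ k (c l • G l) x = c l • iteratedFDeriv ℝ k (G l) x :=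
      iteratedFDeriv_const_smul_apply ((hGs l).of_le (by exact_mod_cast le_top)).contDiffAt
    change ‖iteratedFDeriv ℝ k (c l • G l) x‖ ≤ _
    rw [this, norm_smul]
    gcongr
    exact hA k l x
  have hGB : ∀ l, ∫⁻ x in V, ‖G l x‖ₑ ≤ ((A 0 * (volume (U : Set (Fin d → ℝ))).toNNReal : ℝ≥0) : ℝ≥0∞) := by
    intro l
    refine (lintegral_mono_set hVU).trans ?_
    refine (setLIntegral_mono' (g := fun _ => (A 0 : ℝ≥0∞)) U.isOpen.measurableSet
      fun x _ => ?_).trans ?_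
    · have := hA 0 l x
      rw [norm_iteratedFDeriv_zero] at this
      exact ENNReal.coe_le_coe.2 (by exact_mod_cast this)
    · rw [setLIntegral_const, ENNReal.coe_mul, ENNReal.coe_toNNReal hvol]
  -- Both `P(∂) T` and the smooth function `∑ c_l G_l` are weak limits on `V` of the same series,
  -- because `χ = 1` there.
  have hPT : IsSmoothDist (distDiffOp P T) := by
    refine ⟨_, hsmooth.contDiffOn, fun φ => (hTSP φ).unique ?_⟩
    have h1 := hasSum_integral_smul_tsum
      (fun l => (hGs l).continuous.aestronglyMeasurable) hc hGB φ
    convert h1 using 4 with l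
    rw [distDiffOp_apply_of_contDiffOn P (hsV l) (hS l)]
    refine integral_congr_ae (ae_of_all _ fun x => ?_)
    by_cases hx : x ∈ V
    · simp [hG, hone x hx]
    · simp [image_eq_zero_of_notMem_tsupport fun h => hx (φ.tsupport_subset h)]
  obtain ⟨g, hg, hgT⟩ := hP V T hPT
  refine ⟨g, hg, fun α φ => ?_⟩
  rw [← distMultiDeriv_apply_of_contDiffOn hg hgT]
  simp only [← distMultiDeriv_apply_of_contDiffOn (hsV _) (hS _)]
  exact hTSα α φ

end Series

end SeriesOfSolutions

/-! ### Banach-Steinhaus on `ℓ^1`. -/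

section UniformBoundedness

open Metric

variable {𝕜 : Type*} [RCLike 𝕜] {d : ℕ}

/-- A continuous function is bounded at a point by its averages near this point. -/
lemma norm_le_of_forall_testFunction {V : Opens (Fin d → ℝ)} {F : (Fin d → ℝ) → 𝕜}
    (hF : ContinuousOn F V) {x : Fin d → ℝ} {ε C : ℝ} (hε : 0 < ε)
    (hV : closedBall x ε ⊆ V)
    (h : ∀ φ : 𝓓(V, ℝ), tsupport φ ⊆ closedBall x ε → ∫ y, ‖φ y‖ ≤ 1 →
      ‖∫ y, φ y • F y‖ ≤ C) : ‖F x‖ ≤ C := by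
  refine le_of_forall_pos_le_add fun δ hδ => ?_
  have hxV : x ∈ V := hV (mem_closedBall_self hε.le)
  obtain ⟨s, hs, hs'⟩ := Metric.continuousAt_iff.1 (hF.continuousAt (V.isOpen.mem_nhds hxV)) δ hδ
  set t := min s ε
  have ht : 0 < t := lt_min hs hε
  -- With `t = min s ε`, the support of the bump lies both in the prescribed ball and where `F`
  -- differs from `F x` by less than `δ`.
  let f : ContDiffBump x := ⟨t / 3, t / 2, by positivity, by linarith⟩
  have hts : tsupport (f.normed volume) = closedBall x (t / 2) := f.tsupport_normed_eq
  have hsub : closedBall x (t / 2) ⊆ closedBall x ε :=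
    closedBall_subset_closedBall (by linarith [min_le_right s ε])
  let φ : 𝓓(V, ℝ) := ⟨f.normed volume, f.contDiff_normed, f.hasCompactSupport_normed,
    hts ▸ hsub.trans hV⟩
  have hφ0 : ∀ y, 0 ≤ φ y := f.nonneg_normed
  have hφ1 : ∫ y, φ y = 1 := f.integral_normed
  have hφi : Integrable φ := f.integrable_normed
  have hb := h φ (hts ▸ hsub) (by simp only [Real.norm_of_nonneg (hφ0 _), hφ1, le_refl])
  have hloc : LocallyIntegrableOn F V := hF.locallyIntegrableOn V.isOpen.measurableSet
  have hi : Integrable fun y => φ y • F y :=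
    TestFunction.integrable_bilin (𝕜 := ℝ) (ContinuousLinearMap.lsmul ℝ ℝ) hloc φ
  have h1 : F x = ∫ y, φ y • F x := by rw [integral_smul_const, hφ1, one_smul]
  have h2 : ‖∫ y, φ y • (F x - F y)‖ ≤ δ := by
    calc ‖∫ y, φ y • (F x - F y)‖ ≤ ∫ y, φ y * δ := by
          refine norm_integral_le_of_norm_le (hφi.mul_const δ) (ae_of_all _ fun y => ?_)
          rw [norm_smul, Real.norm_of_nonneg (hφ0 y)]
          by_cases hy : y ∈ closedBall x (t / 2)
          · refine mul_le_mul_of_nonneg_left ?_ (hφ0 y)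
            rw [← dist_eq_norm, dist_comm]
            refine (hs' ?_).le
            have := mem_closedBall.1 hy
            linarith [min_le_left s ε]
          · have : φ y = 0 := image_eq_zero_of_notMem_tsupport (f := φ) (by
              change y ∉ tsupport (f.normed volume)
              rwa [hts])
            simp [this]
      _ = δ := by rw [integral_mul_const, hφ1, one_mul]
  have h3 : F x = (∫ y, φ y • (F x - F y)) + ∫ y, φ y • F y := by
    rw [← integral_add _ hi]
    · simpa only [← smul_add, sub_add_cancel] using h1
    · simp only [smul_sub]
      exact (hφi.smul_const _).sub hi
  rw [h3, add_comm C]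
  exact (norm_add_le _ _).trans (add_le_add h2 hb)

section Uniform

variable {U V : Opens (Fin d → ℝ)} {B : ℝ≥0} {h : ℕ → (Fin d → ℝ) → 𝕜}

/-- Moving `∂^β` to `φ` leaves only the `L^1` bound on `h l`. The constant depends on `φ`; it serves
to make each functional continuous on `ℓ^1`. -/
lemma exists_norm_integral_smul_multiDeriv_le (hVU : V ≤ U) (hs : ∀ l, ContDiffOn ℝ ∞ (h l) U)
    (hB : ∀ l, ∫⁻ x in U, ‖h l x‖ₑ ≤ B) (β : Fin d →₀ ℕ) (φ : 𝓓(V, ℝ)) :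
    ∃ C : ℝ, ∀ l, ‖∫ x, φ x • multiDeriv β (h l) x‖ ≤ C := by
  have hsV : ∀ l, ContDiffOn ℝ ∞ (h l) V := fun l => (hs l).mono hVU
  choose S hS using fun l => exists_distribution_of_locallyIntegrableOn
    ((hsV l).continuousOn.locallyIntegrableOn V.isOpen.measurableSet)
  obtain ⟨ψ, hψ⟩ := exists_distMultiDeriv_apply_eq (𝕜 := 𝕜) β φ
  obtain ⟨D, hD⟩ := ψ.hasCompactSupport.exists_bound_of_continuous ψ.continuous
  have hD0 : 0 ≤ D := (norm_nonneg _).trans (hD 0)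
  refine ⟨D * B, fun l => ?_⟩
  rw [← distMultiDeriv_apply_of_contDiffOn (hsV l) (hS l), hψ, hS]
  have hm : AEStronglyMeasurable (h l) (volume.restrict U) :=
    (hs l).continuousOn.aestronglyMeasurable U.isOpen.measurableSet
  have hi : Integrable (h l) (volume.restrict U) := ⟨hm, (hB l).trans_lt ENNReal.coe_lt_top⟩
  rw [← setIntegral_eq_integral_of_forall_compl_eq_zero (s := U) fun x hx => by
      rw [image_eq_zero_of_notMem_tsupport fun h => hx (hVU (ψ.tsupport_subset h)), zero_smul]]
  refine (norm_integral_le_of_norm_le (hi.norm.const_mul D) (ae_of_all _ fun x => ?_)).trans ?_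
  · rw [norm_smul]
    gcongr
    exact hD x
  · rw [integral_const_mul, integral_norm_eq_lintegral_enorm hm]
    gcongr
    exact ENNReal.toReal_le_coe_of_le_coe (hB l)

/-- By the uniform boundedness principle on `ℓ^1`, the derivatives at a point are bounded along
sequences of smooth functions which are bounded in `L^1` and whose images under a hypoelliptic
operator are bounded in all Sobolev norms. -/
theorem exists_norm_multiDeriv_le {P : MvPolynomial (Fin d) 𝕜} (hP : IsHypoelliptic P)
    {q : ℕ} (hq : 0 < q) (hvol : volume (U : Set (Fin d → ℝ)) ≠ ⊤) (hVU : V ≤ U)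
    {χ : (Fin d → ℝ) → ℝ} (hχ : ContDiff ℝ ∞ χ) (hcomp : HasCompactSupport χ)
    (hsupp : tsupport χ ⊆ U) (hone : ∀ x ∈ V, χ x = 1) {x₀ : Fin d → ℝ} (hx₀ : x₀ ∈ V)
    (hs : ∀ l, ContDiffOn ℝ ∞ (h l) U) (hB : ∀ l, ∫⁻ x in U, ‖h l x‖ₑ ≤ B)
    (hM : ∀ k, ∃ M : ℝ≥0, ∀ l, lqNorm q U (fun _ => 1) k (diffOp P (h l)) ≤ M)
    (β : Fin d →₀ ℕ) : ∃ C : ℝ, ∀ l, ‖multiDeriv β (h l) x₀‖ ≤ C := by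
  obtain ⟨ε, hε, hεV⟩ := nhds_basis_closedBall.mem_iff.1 (V.isOpen.mem_nhds hx₀)
  -- Supports stay in one compact subset of `V`, where the derivatives of any smooth limit are
  -- bounded; the `L^1` normalisation makes that bound independent of `φ`.
  let I := {φ : 𝓓(V, ℝ) // tsupport φ ⊆ closedBall x₀ ε ∧ ∫ y, ‖φ y‖ ≤ 1}
  have ha : ∀ φ : I, Memℓp (fun l => ∫ x, φ.1 x • multiDeriv β (h l) x) ∞ := fun φ => by
    obtain ⟨C, hC⟩ := exists_norm_integral_smul_multiDeriv_le hVU hs hB β φ.1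
    exact memℓp_infty ⟨C, by rintro _ ⟨l, rfl⟩; exact hC l⟩
  let Λ : I → (lp (fun _ : ℕ => 𝕜) 1 →L[𝕜] 𝕜) := fun φ =>
    lp.dualPairing ∞ 1 (fun _ => ContinuousLinearMap.mul 𝕜 𝕜) (K := 1)
      (fun _ => ContinuousLinearMap.opNorm_mul_le 𝕜 𝕜) ⟨_, ha φ⟩
  have hΛ : ∀ φ c, Λ φ c = ∑' l, (∫ x, φ.1 x • multiDeriv β (h l) x) * c l := fun φ c =>
    lp.dualPairing_apply _ _ _ _
  -- Hypoellipticity enters here: for fixed `c` the series is a smooth `g` on `V`, and the supremum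
  -- of `|∂^β g|` over the closed ball bounds all functionals at `c`.
  obtain ⟨C, hC⟩ := banach_steinhaus (g := Λ) fun c => by
    have hc : Summable fun l => ‖c l‖ := by
      have := (memℓp_gen_iff (p := 1) (by simp)).1 (lp.memℓp c)
      simpa using this
    obtain ⟨g, hg, hgs⟩ := exists_contDiffOn_hasSum_integral hP hq hvol hVU hχ hcomp hsupp hone
      hs hB hM hc
    have hgc := ((localLinear_multiDeriv V.isOpen β).smooth g hg).continuousOn
    obtain ⟨D, hD⟩ := (isCompact_closedBall x₀ ε).exists_bound_of_continuousOn (hgc.mono hεV)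
    refine ⟨D, fun φ => ?_⟩
    have h1 : Λ φ c = ∫ x, φ.1 x • multiDeriv β g x := by
      rw [hΛ, ← (hgs β φ.1).tsum_eq]
      simp only [mul_comm]
    have hφi : Integrable φ.1 :=
      φ.1.continuous.integrable_of_hasCompactSupport φ.1.hasCompactSupport
    have hD0 : 0 ≤ D := (norm_nonneg _).trans (hD x₀ (mem_closedBall_self hε.le))
    rw [h1]
    refine (norm_integral_le_of_norm_le (hφi.norm.mul_const D) (ae_of_all _ fun x => ?_)).trans ?_
    · rw [norm_smul]
      by_cases hx : x ∈ closedBall x₀ ε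
      · gcongr
        exact hD x hx
      · simp [image_eq_zero_of_notMem_tsupport fun h => hx (φ.2.1 h)]
    · rw [integral_mul_const]
      exact mul_le_of_le_one_left hD0 φ.2.2
  refine ⟨C, fun l => norm_le_of_forall_testFunction
    ((localLinear_multiDeriv V.isOpen β).smooth _ ((hs l).mono hVU)).continuousOn hε hεV
    fun φ hφ hφ1 => ?_⟩
  -- The unit vector at `l` isolates the single function `h l`, and it has norm one.
  have h1 : Λ ⟨φ, hφ, hφ1⟩ (lp.single 1 l 1) = ∫ y, φ y • multiDeriv β (h l) y := by
    rw [hΛ, tsum_eq_single l]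
    · simp
    · intro b hb
      simp [hb]
  rw [← h1]
  refine ((Λ ⟨φ, hφ, hφ1⟩).le_opNorm _).trans ?_
  rw [lp.norm_single (by simp)]
  simpa using hC _

end Uniform

end UniformBoundedness

/-! ### Interior estimate on balls of fixed radius. -/

section InteriorEstimate

open Metric

variable {𝕜 : Type*} [RCLike 𝕜] {d : ℕ}

section Auxiliary

variable {U : Set (Fin d → ℝ)} {f g : (Fin d → ℝ) → 𝕜}

lemma lqNorm_congr {q : ℕ} {w : (Fin d → ℝ) → ℝ} {m : ℕ} (hU : IsOpen U) (h : EqOn f g U) :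
    lqNorm q U w m f = lqNorm q U w m g := by
  refine iSup_congr fun α => iSup_congr fun _ => eLpNorm_congr_ae ?_
  filter_upwards [ae_restrict_mem hU.measurableSet] with x hx
  rw [(localLinear_multiDeriv hU α).congr f g h hx]

lemma multiDeriv_smul (hU : IsOpen U) (hf : ContDiffOn ℝ ∞ f U) (a : 𝕜) (α : Fin d →₀ ℕ) :
    EqOn (multiDeriv α (a • f)) (a • multiDeriv α f) U := fun x hx => by
  simpa using (localLinear_multiDeriv (𝕜 := 𝕜) hU α).lin f f hf hf a 0 hx

lemma diffOp_smul (hU : IsOpen U) (hf : ContDiffOn ℝ ∞ f U) (a : 𝕜)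
    (P : MvPolynomial (Fin d) 𝕜) : EqOn (diffOp P (a • f)) (a • diffOp P f) U := fun x hx => by
  simp only [diffOp, Pi.smul_apply, smul_eq_mul, Finset.mul_sum]
  refine Finset.sum_congr rfl fun α _ => ?_
  rw [multiDeriv_smul hU hf a α hx, Pi.smul_apply, smul_eq_mul, mul_left_comm]

lemma diffOp_one (f : (Fin d → ℝ) → 𝕜) : diffOp 1 f = f := by
  classical
  funext x
  have h : (1 : MvPolynomial (Fin d) 𝕜).support = {0} := MvPolynomial.support_one
  simp [diffOp, h, multiDeriv_zero]

/-- With this operator the interior estimate becomes a local Sobolev inequality, which is what the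
comparison of the two spaces needs. -/
lemma isHypoelliptic_one : IsHypoelliptic (1 : MvPolynomial (Fin d) 𝕜) := by
  classical
  intro U T hT
  have h : (1 : MvPolynomial (Fin d) 𝕜).support = {0} := MvPolynomial.support_one
  have h0 : distMultiDeriv 0 T = T := by
    unfold distMultiDeriv
    induction List.finRange d with
    | nil => rfl
    | cons i l ih => rw [List.foldr_cons, ih]; rfl
  have : distDiffOp 1 T = T := by simp [distDiffOp, h, h0]
  rwa [this] at hT

lemma multiDeriv_comp_add_left (α : Fin d →₀ ℕ) (x : Fin d → ℝ) (f : (Fin d → ℝ) → 𝕜) :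
    multiDeriv α (fun y => f (x + y)) = fun y => multiDeriv α f (x + y) := by
  have h1 : ∀ (i : Fin d) (f : (Fin d → ℝ) → 𝕜),
      pderiv i (fun y => f (x + y)) = fun y => pderiv i f (x + y) := fun i f => by
    funext y
    simp only [pderiv, lineDeriv, add_assoc]
  have h2 : ∀ (i : Fin d) (n : ℕ) (f : (Fin d → ℝ) → 𝕜),
      (pderiv i)^[n] (fun y => f (x + y)) = fun y => (pderiv i)^[n] f (x + y) := by
    intro i n
    induction n with
    | zero => exact fun f => rfl
    | succ n ih => intro f; rw [Function.iterate_succ_apply, h1, ih]; rfl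
  unfold multiDeriv
  induction List.finRange d with
  | nil => rfl
  | cons i l ih => rw [List.foldr_cons, ih, h2]; rfl

lemma diffOp_comp_add_left (P : MvPolynomial (Fin d) 𝕜) (x : Fin d → ℝ)
    (f : (Fin d → ℝ) → 𝕜) :
    diffOp P (fun y => f (x + y)) = fun y => diffOp P f (x + y) := by
  funext y
  simp only [diffOp, multiDeriv_comp_add_left]

lemma lqNorm_ball_comp_add_left (q m : ℕ) (x : Fin d → ℝ) (r : ℝ) (f : (Fin d → ℝ) → 𝕜) :
    lqNorm q (ball 0 r) (fun _ => 1) m (fun y => f (x + y)) =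
      lqNorm q (ball x r) (fun _ => 1) m f := by
  refine iSup_congr fun α => iSup_congr fun _ => ?_
  have hemb : MeasurableEmbedding fun y : Fin d → ℝ => x + y := measurableEmbedding_addLeft x
  have hpre : (fun y : Fin d → ℝ => x + y) ⁻¹' ball x r = ball 0 r := by
    ext y
    simp [dist_eq_norm]
  have hmp := (measurePreserving_add_left (volume : Measure (Fin d → ℝ)) x).restrict_preimage_emb
    hemb (ball x r)
  rw [hpre] at hmp
  rw [multiDeriv_comp_add_left, ← hmp.map_eq, hemb.eLpNorm_map_measure]
  rfl

end Auxiliary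

/-- Were it false for each `l`, the rescaled counterexamples would satisfy the hypotheses of
`exists_norm_multiDeriv_le` while their derivatives at `0` have modulus `l`. One number serves as
both constant and order, so that the negation yields a single sequence. -/
lemma exists_enorm_multiDeriv_zero_le {P : MvPolynomial (Fin d) 𝕜} (hP : IsHypoelliptic P)
    {q : ℕ} (hq : 0 < q) {r : ℝ} (hr : 0 < r) (β : Fin d →₀ ℕ) :
    ∃ l : ℕ, ∀ f : (Fin d → ℝ) → 𝕜, ContDiffOn ℝ ∞ f (ball 0 r) →
      lqNorm q (ball 0 r) (fun _ => 1) 0 f < ⊤ →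
      (∀ k, lqNorm q (ball 0 r) (fun _ => 1) k (diffOp P f) < ⊤) →
      ‖multiDeriv β f 0‖ₑ ≤ l * (lqNorm q (ball 0 r) (fun _ => 1) 0 f +
        lqNorm q (ball 0 r) (fun _ => 1) l (diffOp P f)) := by
  by_contra! hcon
  choose f hf hf0 hfP hlt using hcon
  let U : Opens (Fin d → ℝ) := ⟨ball 0 r, isOpen_ball⟩
  let V : Opens (Fin d → ℝ) := ⟨ball 0 (r / 2), isOpen_ball⟩
  have h0U : (0 : Fin d → ℝ) ∈ ball (0 : Fin d → ℝ) r := mem_ball_self hr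
  have hvol : volume (U : Set (Fin d → ℝ)) ≠ ⊤ := measure_ball_lt_top.ne
  let χ : ContDiffBump (0 : Fin d → ℝ) := ⟨r / 2, 3 * r / 4, by positivity, by linarith⟩
  have hχs : tsupport χ ⊆ U := by
    rw [χ.tsupport_eq]
    exact closedBall_subset_ball (by change 3 * r / 4 < r; linarith)
  have hb : ∀ l, ‖multiDeriv β (f l) 0‖ ≠ 0 := fun l h => by
    have := hlt l
    rw [← ofReal_norm, h, ENNReal.ofReal_zero] at this
    exact not_lt_zero this
  -- The scaling makes the modulus of `∂^β` at `0` exactly `l`, while the bracket on the right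
  -- becomes at most `1`.
  set s : ℕ → ℝ := fun l => l / ‖multiDeriv β (f l) 0‖ with hs
  have hs1 : ∀ l, ‖((s l : ℝ) : 𝕜)‖ₑ * (lqNorm q (ball 0 r) (fun _ => 1) 0 (f l) +
      lqNorm q (ball 0 r) (fun _ => 1) l (diffOp P (f l))) ≤ 1 := fun l => by
    have h1 : ‖((s l : ℝ) : 𝕜)‖ₑ = l / ‖multiDeriv β (f l) 0‖ₑ := by
      rw [← ofReal_norm, RCLike.norm_ofReal, abs_of_nonneg (by positivity), hs,
        ENNReal.ofReal_div_of_pos (lt_of_le_of_ne (norm_nonneg _) (hb l).symm), ofReal_norm,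
        ENNReal.ofReal_natCast]
    rw [h1, div_eq_mul_inv, mul_right_comm, ← div_eq_mul_inv]
    exact ENNReal.div_le_of_le_mul (by simpa using (hlt l).le)
  set h : ℕ → (Fin d → ℝ) → 𝕜 := fun l => ((s l : ℝ) : 𝕜) • f l with hh
  have hhs : ∀ l, ContDiffOn ℝ ∞ (h l) U := fun l => contDiffOn_const.smul (hf l)
  have hh0 : ∀ l, lqNorm q (ball 0 r) (fun _ => 1) 0 (h l) ≤ 1 := fun l => by
    rw [hh, lqNorm_smul isOpen_ball (hf l)]
    refine le_trans ?_ (hs1 l)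
    gcongr
    exact le_self_add
  have hhP : ∀ k l, lqNorm q (ball 0 r) (fun _ => 1) k (diffOp P (h l)) =
      ‖((s l : ℝ) : 𝕜)‖ₑ * lqNorm q (ball 0 r) (fun _ => 1) k (diffOp P (f l)) := fun k l => by
    rw [hh, lqNorm_congr isOpen_ball (diffOp_smul isOpen_ball (hf l) _ P),
      lqNorm_smul isOpen_ball (contDiffOn_diffOp isOpen_ball P (hf l))]
  have hhPfin : ∀ k l, lqNorm q (ball 0 r) (fun _ => 1) k (diffOp P (h l)) ≠ ⊤ := fun k l => by
    rw [hhP]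
    exact ENNReal.mul_ne_top enorm_ne_top (hfP l k).ne
  obtain ⟨A, hA⟩ := exists_lintegral_enorm_le_eLpNorm (𝕜 := 𝕜) hq hvol
  have hB : ∀ l, ∫⁻ x in U, ‖h l x‖ₑ ≤ A := fun l => by
    refine (hA _ ((hhs l).continuousOn.aestronglyMeasurable U.isOpen.measurableSet)).trans ?_
    refine mul_le_of_le_one_right' (le_trans ?_ (hh0 l))
    have h1 := eLpNorm_multiDeriv_le_lqNorm (U := ball 0 r) (m := 0) q (fun _ => 1) (h l)
      (α := 0) (by simp [order])
    simp only [one_smul, multiDeriv_zero] at h1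
    exact h1
  -- For `l ≥ k` the norm of order `k` is at most that of order `l`, hence at most `1`; the finitely
  -- many remaining terms are finite.
  have hM : ∀ k, ∃ M : ℝ≥0, ∀ l, lqNorm q U (fun _ => 1) k (diffOp P (h l)) ≤ M := by
    intro k
    refine ⟨1 + ∑ l ∈ Finset.range k,
      (lqNorm q (ball 0 r) (fun _ => 1) k (diffOp P (h l))).toNNReal, fun l => ?_⟩
    push_cast
    rcases lt_or_ge l k with hl | hl
    · refine le_trans ?_ le_add_self
      simp only [ENNReal.coe_toNNReal (hhPfin k _)]
      exact Finset.single_le_sum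
        (f := fun l => lqNorm q (ball 0 r) (fun _ => 1) k (diffOp P (h l)))
        (fun _ _ => zero_le) (Finset.mem_range.2 hl)
    · refine le_trans ((lqNorm_mono q _ hl _).trans ?_) le_self_add
      refine le_trans ?_ (hs1 l)
      change lqNorm q (ball 0 r) (fun _ => 1) l (diffOp P (h l)) ≤ _
      rw [hhP]
      gcongr
      exact le_add_self
  obtain ⟨C, hC⟩ := exists_norm_multiDeriv_le (V := V) hP hq hvol (ball_subset_ball (by linarith))
    χ.contDiff χ.hasCompactSupport hχs
    (fun x hx => χ.one_of_mem_closedBall (ball_subset_closedBall hx))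
    (x₀ := 0) (mem_ball_self (by positivity)) hhs hB hM β
  obtain ⟨l, hl⟩ := exists_nat_gt C
  refine absurd (hC l) (not_le.2 (hl.trans_eq ?_))
  rw [hh, multiDeriv_smul isOpen_ball (hf l) _ β h0U, Pi.smul_apply, norm_smul, RCLike.norm_ofReal,
    abs_of_nonneg (by positivity), hs, div_mul_cancel₀ _ (hb l)]

/-- **Interior estimate** for hypoelliptic operators, uniform with respect to translations. -/
theorem exists_enorm_multiDeriv_le {P : MvPolynomial (Fin d) 𝕜} (hP : IsHypoelliptic P)
    {q : ℕ} (hq : 0 < q) {r : ℝ} (hr : 0 < r) (β : Fin d →₀ ℕ) :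
    ∃ l : ℕ, ∀ (x : Fin d → ℝ) (f : (Fin d → ℝ) → 𝕜), ContDiffOn ℝ ∞ f (ball x r) →
      lqNorm q (ball x r) (fun _ => 1) 0 f < ⊤ →
      (∀ k, lqNorm q (ball x r) (fun _ => 1) k (diffOp P f) < ⊤) →
      ‖multiDeriv β f x‖ₑ ≤ l * (lqNorm q (ball x r) (fun _ => 1) 0 f +
        lqNorm q (ball x r) (fun _ => 1) l (diffOp P f)) := by
  obtain ⟨l, h⟩ := exists_enorm_multiDeriv_zero_le hP hq hr β
  refine ⟨l, fun x f hf hf0 hfP => ?_⟩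
  have hmaps : MapsTo (fun y : Fin d → ℝ => x + y) (ball 0 r) (ball x r) := fun y hy => by
    simpa [dist_eq_norm] using hy
  have := h (fun y => f (x + y))
    (hf.comp (contDiff_const.add contDiff_id).contDiffOn hmaps)
  simpa only [diffOp_comp_add_left, lqNorm_ball_comp_add_left, multiDeriv_comp_add_left,
    add_zero, hf0, hfP, implies_true, true_imp_iff] using this

end InteriorEstimate

/-! ### Weighted estimates and equality of the spaces. -/

section WeightedEstimates

open Metric

namespace WeightSystem

variable {𝕜 : Type*} [RCLike 𝕜] {d : ℕ} (V : WeightSystem d) {q : ℕ}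

lemma sub_monotone : Monotone V.sub := fun m n h => by
  induction n using PNat.recOn with
  | one => rw [le_one_iff_eq_one.1 h]
  | succ n ih =>
    rcases h.lt_or_eq with h | rfl
    · exact (ih (PNat.lt_add_one_iff.1 h)).trans (V.sub_mono n)
    · exact le_rfl

lemma weight_le_weight {m n : ℕ+} (h : m ≤ n) {x : Fin d → ℝ} (hx : x ∈ V.dom) :
    V.weight m x ≤ V.weight n x := by
  induction n using PNat.recOn with
  | one => rw [le_one_iff_eq_one.1 h]
  | succ n ih =>
    rcases h.lt_or_eq with h | rfl
    · exact (ih (PNat.lt_add_one_iff.1 h)).trans (V.weight_mono n x hx)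
    · exact le_rfl

variable {V}

namespace Condition

/-- The ball is connected and misses the frontier of `V.sub (n + 1)`. The open set and the
complement of its closure therefore separate it, and its centre decides the side. -/
lemma closedBall_subset (H : V.Condition q) {n : ℕ+} {x : Fin d → ℝ} (hx : x ∈ V.sub n) :
    closedBall x (H.ρ n) ⊆ V.sub (n + 1) := by
  have hxs : x ∈ (V.sub (n + 1) : Set (Fin d → ℝ)) := V.sub_mono n hx
  have hpre : IsPreconnected (closedBall x (H.ρ n)) := (convex_closedBall x _).isPreconnected
  have hxb : x ∈ closedBall x (H.ρ n) := mem_closedBall_self (H.ρ_pos n).le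
  refine hpre.subset_left_of_subset_union (V.sub (n + 1)).isOpen isClosed_closure.isOpen_compl
    (disjoint_compl_right.mono_left subset_closure) (fun z hz => ?_) ⟨x, hxb, hxs⟩
  by_contra hcon
  rw [mem_union, not_or, notMem_compl_iff] at hcon
  have hzf : z ∈ frontier (V.sub (n + 1) : Set (Fin d → ℝ)) := by
    rw [(V.sub (n + 1)).isOpen.frontier_eq]
    exact ⟨hcon.2, hcon.1⟩
  refine absurd (H.ρ_lt n x hx) (not_lt.2 ((infEDist_le_edist_of_mem hzf).trans ?_))
  rw [edist_dist, dist_comm]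
  exact ENNReal.ofReal_le_ofReal (mem_closedBall.1 hz)

lemma weight_le (H : V.Condition q) {n : ℕ+} {x y : Fin d → ℝ} (hx : x ∈ V.sub n)
    (hy : y ∈ closedBall x (H.ρ n)) :
    V.weight n x ≤ H.C₁ n n * V.weight (H.J₁ n n) y := by
  have hsub : closedBall x (H.ρ n) ⊆ V.dom := (H.closedBall_subset hx).trans (V.sub_le _)
  have hxb : x ∈ closedBall x (H.ρ n) := mem_closedBall_self (H.ρ_pos n).le
  -- Boundedness is essential for real `sSup` and `sInf`; it comes from compactness of the ball
  -- inside the domain and from positivity of the weights.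
  have hb : BddAbove (V.weight n '' closedBall x (H.ρ n)) :=
    (isCompact_closedBall x _).bddAbove_image ((V.weight_continuousOn n).mono hsub)
  have hb' : BddBelow (V.weight (H.J₁ n n) '' closedBall x (H.ρ n)) :=
    ⟨0, by rintro _ ⟨z, hz, rfl⟩; exact (V.weight_pos _ z (hsub hz)).le⟩
  calc V.weight n x ≤ sSup (V.weight n '' closedBall x (H.ρ n)) :=
        le_csSup hb (mem_image_of_mem _ hxb)
    _ ≤ H.C₁ n n * sInf (V.weight (H.J₁ n n) '' closedBall x (H.ρ n)) := H.omega_one n n x hx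
    _ ≤ H.C₁ n n * V.weight (H.J₁ n n) y := by
        have := (H.C₁_pos n n).le
        gcongr
        exact csInf_le hb' (mem_image_of_mem _ hy)

/-- The weight at the centre is dominated throughout the ball by a multiple of `V.weight N`, so it
can be moved under the integral; the ball is then enlarged to `V.sub N`. -/
lemma ofReal_weight_mul_lqNorm_ball_le (H : V.Condition q) {n N : ℕ+} (hN : n + 1 ≤ N)
    (hN' : H.J₁ n n ≤ N) {x : Fin d → ℝ} (hx : x ∈ V.sub n) (k : ℕ) (f : (Fin d → ℝ) → 𝕜) :
    ENNReal.ofReal (V.weight n x) * lqNorm q (ball x (H.ρ n)) (fun _ => 1) k f ≤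
      (H.C₁ n n).toNNReal * V.lqNormAt q N k f := by
  have hsub : closedBall x (H.ρ n) ⊆ V.sub N := (H.closedBall_subset hx).trans (V.sub_monotone hN)
  have hw := (V.weight_pos n x (V.sub_le n hx)).le
  simp only [lqNorm, ENNReal.mul_iSup]
  refine iSup₂_le fun α hα => ?_
  have h1 : ENNReal.ofReal (V.weight n x) = ‖V.weight n x‖ₑ := (Real.enorm_of_nonneg hw).symm
  rw [h1, ← eLpNorm_const_smul]
  have h2 : ∀ᵐ y ∂volume.restrict (ball x (H.ρ n)),
      ‖(V.weight n x • fun y => (1 : ℝ) • multiDeriv α f y) y‖₊ ≤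
        (H.C₁ n n).toNNReal * ‖V.weight N y • multiDeriv α f y‖₊ := by
    filter_upwards [ae_restrict_mem measurableSet_ball] with y hy
    have hy' := ball_subset_closedBall hy
    have hyd : y ∈ V.dom := V.sub_le N (hsub hy')
    rw [← NNReal.coe_le_coe]
    simp only [Pi.smul_apply, one_smul, nnnorm_smul, NNReal.coe_mul, coe_nnnorm, ← mul_assoc,
      Real.norm_of_nonneg hw, Real.norm_of_nonneg (V.weight_pos N y hyd).le,
      Real.coe_toNNReal _ (H.C₁_pos n n).le]
    gcongr
    refine (H.weight_le hx hy').trans ?_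
    have := (H.C₁_pos n n).le
    gcongr
    exact V.weight_le_weight hN' hyd
  refine (eLpNorm_le_nnreal_smul_eLpNorm_of_ae_le_mul h2 _).trans ?_
  rw [ENNReal.smul_def, smul_eq_mul]
  gcongr
  refine (eLpNorm_mono_measure _ (Measure.restrict_mono
    (ball_subset_closedBall.trans hsub) le_rfl)).trans ?_
  exact eLpNorm_multiDeriv_le_lqNorm q (V.weight N) f hα

lemma lqNorm_ball_lt_top (H : V.Condition q) {n N : ℕ+} (hN : n + 1 ≤ N)
    (hN' : H.J₁ n n ≤ N) {x : Fin d → ℝ} (hx : x ∈ V.sub n) {k : ℕ} {f : (Fin d → ℝ) → 𝕜}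
    (hf : V.lqNormAt q N k f < ⊤) : lqNorm q (ball x (H.ρ n)) (fun _ => 1) k f < ⊤ := by
  have h1 := (H.ofReal_weight_mul_lqNorm_ball_le hN hN' hx k f).trans_lt
    (ENNReal.mul_lt_top ENNReal.coe_lt_top hf)
  exact ENNReal.lt_top_of_mul_ne_top_right h1.ne
    (ENNReal.ofReal_pos.2 (V.weight_pos n x (V.sub_le n hx))).ne'

/-- Weighted sup-norms are bounded by weighted `L^q`-norms of `f` and of `P(∂) f`, for
hypoelliptic `P(∂)`. -/
theorem exists_supNormAt_le (H : V.Condition q) (hq : 0 < q) {P : MvPolynomial (Fin d) 𝕜}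
    (hP : IsHypoelliptic P) {n N : ℕ+} (hN : n + 1 ≤ N) (hN' : H.J₁ n n ≤ N) (m : ℕ) :
    ∃ (l : ℕ) (C : ℝ≥0), 0 < C ∧ ∀ f : (Fin d → ℝ) → 𝕜, ContDiffOn ℝ ∞ f (V.sub N) →
      V.lqNormAt q N 0 f < ⊤ → V.MemC q N (diffOp P f) →
        V.supNormAt n m f ≤ C * (V.lqNormAt q N 0 f + V.lqNormAt q N l (diffOp P f)) := by
  choose l hl using fun β => exists_enorm_multiDeriv_le hP hq (H.ρ_pos n) β
  -- Only finitely many multi-indices occur, so one `L` serves all of them.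
  have hfin : {β : Fin d →₀ ℕ | order β ≤ m}.Finite := by
    refine (Set.finite_Iic (Finsupp.equivFunOnFinite.symm fun _ : Fin d => m)).subset
      fun β hβ i => ?_
    exact (Finset.single_le_sum (f := fun i => β i) (fun _ _ => Nat.zero_le _)
      (Finset.mem_univ i)).trans hβ
  obtain ⟨L, hL⟩ := (hfin.image l).bddAbove
  have hL' : ∀ β, order β ≤ m → l β ≤ L := fun β hβ => hL (mem_image_of_mem l hβ)
  -- The summand `1` only makes the constant positive, since `L` may be zero.
  refine ⟨L, L * (H.C₁ n n).toNNReal + 1, by positivity, fun f hf hf0 hfP => ?_⟩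
  refine iSup₂_le fun β hβ => iSup₂_le fun x hx => ?_
  have hball : ball x (H.ρ n) ⊆ V.sub N :=
    ball_subset_closedBall.trans ((H.closedBall_subset hx).trans (V.sub_monotone hN))
  have h1 := hl β x f (hf.mono hball) (H.lqNorm_ball_lt_top hN hN' hx hf0)
    fun k => H.lqNorm_ball_lt_top hN hN' hx (hfP.2 k)
  calc ‖multiDeriv β f x‖ₑ * ENNReal.ofReal (V.weight n x)
      ≤ (L * (lqNorm q (ball x (H.ρ n)) (fun _ => 1) 0 f +
          lqNorm q (ball x (H.ρ n)) (fun _ => 1) L (diffOp P f))) *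
          ENNReal.ofReal (V.weight n x) := by
        gcongr
        refine h1.trans ?_
        gcongr
        · exact hL' β hβ
        · exact lqNorm_mono q _ (hL' β hβ) _
    _ = L * (ENNReal.ofReal (V.weight n x) * lqNorm q (ball x (H.ρ n)) (fun _ => 1) 0 f +
          ENNReal.ofReal (V.weight n x) *
            lqNorm q (ball x (H.ρ n)) (fun _ => 1) L (diffOp P f)) := by ring
    _ ≤ L * ((H.C₁ n n).toNNReal * V.lqNormAt q N 0 f +
          (H.C₁ n n).toNNReal * V.lqNormAt q N L (diffOp P f)) := by
        exact mul_le_mul' le_rfl (add_le_add (H.ofReal_weight_mul_lqNorm_ball_le hN hN' hx 0 f)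
          (H.ofReal_weight_mul_lqNorm_ball_le hN hN' hx L _))
    _ = (L * (H.C₁ n n).toNNReal : ℝ≥0) *
          (V.lqNormAt q N 0 f + V.lqNormAt q N L (diffOp P f)) := by
        push_cast
        ring
    _ ≤ _ := by
        gcongr
        exact le_self_add

/-- Weighted `L^q`-norms are bounded by weighted sup-norms. -/
theorem exists_lqNormAt_le (H : V.Condition q) (n : ℕ+) :
    ∃ C : ℝ≥0, ∀ (m : ℕ) (f : (Fin d → ℝ) → 𝕜), V.supNormAt (H.J₂ n n) m f < ⊤ →
      V.lqNormAt q n m f ≤ C * V.supNormAt (H.J₂ n n) m f := by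
  have hψ := H.ψ_memLp n n
  have hC := (H.C₂_pos n n).le
  -- The pointwise bound is the sup norm times `C₂ ψ`, so integration leaves the `L^q` norm of `ψ`,
  -- a constant independent of `m`.
  refine ⟨(H.C₂ n n).toNNReal * (eLpNorm (H.ψ n n) q (volume.restrict (V.sub n))).toNNReal,
    fun m f hS => iSup₂_le fun α hα => ?_⟩
  set S := V.supNormAt (H.J₂ n n) m f
  have h1 : ∀ᵐ x ∂volume.restrict (V.sub n : Set (Fin d → ℝ)),
      ‖V.weight n x • multiDeriv α f x‖₊ ≤ (H.C₂ n n).toNNReal * S.toNNReal * ‖H.ψ n n x‖₊ := by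
    filter_upwards [ae_restrict_mem (V.sub n).isOpen.measurableSet] with x hx
    have hxd : x ∈ V.dom := V.sub_le n hx
    have hJ := (V.weight_pos (H.J₂ n n) x hxd).le
    have h2 : ‖multiDeriv α f x‖ * V.weight (H.J₂ n n) x ≤ S.toNNReal := by
      have h3 : ‖multiDeriv α f x‖ₑ * ENNReal.ofReal (V.weight (H.J₂ n n) x) ≤ S :=
        le_iSup₂_of_le (f := fun (β : Fin d →₀ ℕ) (_ : order β ≤ m) => ⨆ (x : Fin d → ℝ)
          (_ : x ∈ (V.sub (H.J₂ n n) : Set (Fin d → ℝ))),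
          ‖multiDeriv β f x‖ₑ * ENNReal.ofReal (V.weight (H.J₂ n n) x)) α hα
          (le_iSup₂_of_le x (V.sub_monotone (H.le_J₂ n n) hx) le_rfl)
      have h4 := ENNReal.toReal_mono hS.ne h3
      rwa [ENNReal.toReal_mul, toReal_enorm, ENNReal.toReal_ofReal hJ] at h4
    have hψx := (H.ψ_pos n n x hx).le
    rw [← NNReal.coe_le_coe]
    simp only [nnnorm_smul, NNReal.coe_mul, coe_nnnorm, Real.coe_toNNReal _ hC,
      Real.norm_of_nonneg (V.weight_pos n x hxd).le, Real.norm_of_nonneg hψx]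
    calc V.weight n x * ‖multiDeriv α f x‖
        ≤ H.C₂ n n * H.ψ n n x * V.weight (H.J₂ n n) x * ‖multiDeriv α f x‖ := by
          gcongr
          exact H.omega_two n n x hx
      _ = H.C₂ n n * H.ψ n n x * (‖multiDeriv α f x‖ * V.weight (H.J₂ n n) x) := by ring
      _ ≤ H.C₂ n n * H.ψ n n x * S.toNNReal := by gcongr
      _ = H.C₂ n n * S.toNNReal * H.ψ n n x := by ring
  refine (eLpNorm_le_nnreal_smul_eLpNorm_of_ae_le_mul h1 _).trans_eq ?_
  rw [ENNReal.smul_def, smul_eq_mul]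
  push_cast
  rw [ENNReal.coe_toNNReal hS.ne, ENNReal.coe_toNNReal hψ.2.ne, mul_right_comm]

/-- Weighted sup-norms are bounded by weighted `L^q`-norms. -/
theorem exists_supNormAt_le_lqNormAt (H : V.Condition q) (hq : 0 < q) (n : ℕ+) (m : ℕ) :
    ∃ (N : ℕ+) (l : ℕ) (C : ℝ≥0), ∀ f : (Fin d → ℝ) → 𝕜, V.MemC q N f →
      V.supNormAt n m f ≤ C * V.lqNormAt q N l f := by
  obtain ⟨l, C, -, h⟩ := H.exists_supNormAt_le (𝕜 := 𝕜) hq isHypoelliptic_one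
    (le_max_left (n + 1) (H.J₁ n n)) (le_max_right _ _) m
  -- The factor `2` absorbs the order-zero term into the norm of order `l`.
  refine ⟨max (n + 1) (H.J₁ n n), l, C * 2, fun f hf => ?_⟩
  have h1 := h f hf.1 (hf.2 0)
  rw [diffOp_one] at h1
  refine (h1 hf).trans ?_
  push_cast
  rw [mul_assoc, two_mul]
  gcongr
  exact lqNorm_mono q _ (Nat.zero_le l) f

end Condition

lemma spaceC_eq_spaceE [NeZero q] (H : V.Condition q) : V.spaceC 𝕜 q = V.spaceE 𝕜 := by
  ext f
  refine ⟨fun hf => ⟨hf.1, fun n => ⟨V.smooth_on hf.1 n, fun m => ?_⟩⟩,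
    fun hf => ⟨hf.1, fun n => ⟨V.smooth_on hf.1 n, fun m => ?_⟩⟩⟩
  · obtain ⟨N, l, C, h⟩ := H.exists_supNormAt_le_lqNormAt (𝕜 := 𝕜) (NeZero.pos q) n m
    exact (h _ (hf.2 N)).trans_lt (ENNReal.mul_lt_top ENNReal.coe_lt_top ((hf.2 N).2 l))
  · obtain ⟨C, h⟩ := H.exists_lqNormAt_le (𝕜 := 𝕜) n
    have h1 := (hf.2 (H.J₂ n n)).2 m
    exact (h m _ h1).trans_lt (ENNReal.mul_lt_top ENNReal.coe_lt_top h1)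

/-- The two seminorm comparisons say that the identity is continuous in both directions, hence a
homeomorphism. -/
lemma topologyC_eq_induced_topologyE [NeZero q] (H : V.Condition q)
    (h : V.spaceC 𝕜 q = V.spaceE 𝕜) :
    V.topologyC 𝕜 q = (V.topologyE 𝕜).induced (LinearEquiv.ofEq _ _ h) := by
  let tC := V.topologyC 𝕜 q
  let tE := V.topologyE 𝕜
  have hC : WithSeminorms (V.seminormC 𝕜 q) := ⟨rfl⟩
  have hE : WithSeminorms (V.seminormE 𝕜) := ⟨rfl⟩
  have h1 : Continuous (LinearEquiv.ofEq _ _ h).toLinearMap := by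
    refine WithSeminorms.continuous_of_isBounded hC hE _ fun ⟨n, m⟩ => ?_
    obtain ⟨N, l, C, hN⟩ := H.exists_supNormAt_le_lqNormAt (𝕜 := 𝕜) (NeZero.pos q) n m
    refine ⟨{(N, l)}, C, fun f => ?_⟩
    rw [Finset.sup_singleton]
    have := ENNReal.toReal_mono (ENNReal.mul_ne_top ENNReal.coe_ne_top ((f.2.2 N).2 l).ne)
      (hN _ (f.2.2 N))
    rwa [ENNReal.toReal_mul] at this
  have h2 : Continuous (LinearEquiv.ofEq _ _ h).symm.toLinearMap := by
    refine WithSeminorms.continuous_of_isBounded hE hC _ fun ⟨n, m⟩ => ?_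
    obtain ⟨C, hJ⟩ := H.exists_lqNormAt_le (𝕜 := 𝕜) n
    refine ⟨{(H.J₂ n n, m)}, C, fun f => ?_⟩
    rw [Finset.sup_singleton]
    have hf := (f.2.2 (H.J₂ n n)).2 m
    have := ENNReal.toReal_mono (ENNReal.mul_ne_top ENNReal.coe_ne_top hf.ne) (hJ m _ hf)
    rwa [ENNReal.toReal_mul] at this
  exact Topology.IsInducing.eq_induced
    (Homeomorph.mk (LinearEquiv.ofEq _ _ h).toEquiv h1 h2).isInducing

end WeightSystem

end WeightedEstimates

end WeightedSmooth

/-! ### The main theorem. -/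

theorem mainTheorem4 {𝕜 : Type*} [RCLike 𝕜] (d : ℕ) [NeZero d]
    (V : WeightedSmooth.WeightSystem d) (q : ℕ) [NeZero q] (H : V.Condition q) :
    (∀ P : MvPolynomial (Fin d) 𝕜, WeightedSmooth.IsHypoelliptic P → ∀ n N : ℕ+,
      N = 2 * H.J₁ n (H.J₁ n n) →
        (∀ f : (Fin d → ℝ) → 𝕜, ContDiffOn ℝ ∞ f (V.sub N) → V.lqNormAt q N 0 f < ⊤ →
          V.MemC q N (WeightedSmooth.diffOp P f) → V.MemE n f) ∧
        ∀ m : ℕ, ∃ (l : ℕ) (C₀ : ℝ≥0), 0 < C₀ ∧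
          ∀ f : (Fin d → ℝ) → 𝕜, ContDiffOn ℝ ∞ f (V.sub N) → V.lqNormAt q N 0 f < ⊤ →
            V.MemC q N (WeightedSmooth.diffOp P f) →
              V.supNormAt n m f ≤
                C₀ * (V.lqNormAt q N 0 f + V.lqNormAt q N l (WeightedSmooth.diffOp P f))) ∧
    ∃ h : V.spaceC 𝕜 q = V.spaceE 𝕜,
      V.topologyC 𝕜 q = (V.topologyE 𝕜).induced (LinearEquiv.ofEq _ _ h) := by
  refine ⟨fun P hP n N hN => ?_, WeightedSmooth.WeightSystem.spaceC_eq_spaceE H,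
    WeightedSmooth.WeightSystem.topologyC_eq_induced_topologyE H _⟩
  have hJ : H.J₁ n n ≤ H.J₁ n (H.J₁ n n) := H.le_J₁ n _
  have hn : n ≤ H.J₁ n n := H.le_J₁ n n
  have hN2 : (N : ℕ) = 2 * H.J₁ n (H.J₁ n n) := by rw [hN]; rfl
  have hpos := n.pos
  rw [← PNat.coe_le_coe] at hJ hn
  -- Of the size of `N` only `J₁ n n ≤ N` and `n + 1 ≤ N` matter; the factor `2` secures the latter
  -- through `2n ≥ n + 1`.
  have hN' : H.J₁ n n ≤ N := by rw [← PNat.coe_le_coe]; omega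
  have hN1 : n + 1 ≤ N := by rw [← PNat.coe_le_coe, PNat.add_coe, PNat.one_coe]; omega
  have key := H.exists_supNormAt_le (NeZero.pos q) hP hN1 hN'
  refine ⟨fun f hf hf0 hfP => ⟨hf.mono (V.sub_monotone ((PNat.lt_add_right n 1).le.trans hN1)),
    fun m => ?_⟩, key⟩
  obtain ⟨l, C, -, h⟩ := key m
  exact (h f hf hf0 hfP).trans_lt (ENNReal.mul_lt_top ENNReal.coe_lt_top
    (ENNReal.add_lt_top.2 ⟨hf0, hfP.2 l⟩))
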